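/- For $x,y\in\mathbb{Z}^2$ write $x\sim y$ if $x$ and $y$ are neighbours in the square lattice. Let $(S_n)_{n\ge 0}$ be the simple random walk on $\mathbb{Z}^2$ (transition probability $1/4$ to each neighbour), $\mathbb{P}_x$ its law started at $x$, and let $$a(x)=\sum_{k=0}^{\infty}\big(\mathbb{P}_0[S_k=0]-\mathbb{P}_x[S_k=0]\big)$$ be its potential kernel; the series (understood as the limit of its partial sums) converges for every $x\in\mathbb{Z}^2$, $a(0)=0$, and $a(x)>0$ for $x\ne 0$. The conditioned walk $(\hat S_n)_{n\ge0}$ is the Markov chain on $\mathbb{Z}^2\setminus\{0\}$ with transition probabilities $$\hat P_{xy}=\frac{a(y)}{4a(x)}\ \text{ if } x\sim y,\ x\neq 0,\qquad \hat P_{xy}=0\ \text{ otherwise};$$ it is well defined, i.e. it exists for every starting point $x\ne0$. For a set $A$ (a point $y$ standing for $\{y\}$) let $\hat\tau_0(A)=\inf\{k\ge 0:\hat S_k\in A\}$ and $\hat\tau_1(A)=\inf\{k\ge 1:\hat S_k\in A\}$, with $\inf\emptyset=+\infty$; below $\mathbb{P}_x$ denotes the law of $\hat S$ started at $x\neq 0$.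 The following statements hold. (i) The walk $\hat S$ is reversible on $\mathbb{Z}^2\setminus\{0\}$, with the reversible measure $\mu_x=a(x)^2>0$, i.e. $\mu_x\hat P_{xy}=\mu_y\hat P_{yx}$ for all $x,y\neq0$. (ii) $\hat S$ is the random walk on the two-dimensional lattice with conductances $a(x)a(y)$, $x\sim y$: for $x\ne0$ one has $\sum_{z\sim x}a(x)a(z)>0$ and $\hat P_{xy}=a(x)a(y)\big/\sum_{z\sim x}a(x)a(z)$ for $y\sim x$. (iii) Let $\mathcal N$ be the set of the four neighbours of the origin. For every starting point $x\neq 0$, the process $1/a(\hat S_{n\wedge\hat\tau_0(\mathcal N)})$, $n\geq 0$, is a martingale with respect to the natural filtration of $\hat S$. (iv) $\hat S$ is transient: for every $x\neq0$, $\mathbb{P}_x[\hat\tau_1(x)<\infty]<1$ and, $\mathbb{P}_x$-almost surely, $\hat S$ visits each site only finitely many times. (v) For all $x\neq 0$, $$\mathbb{P}_x[\hat\tau_1(x)<\infty]=1-\frac{1}{2a(x)},$$ and for all $x\neq y$ with $x,y\neq 0$, $$\mathbb{P}_x[\hat\tau_0(y)<\infty]=\mathbb{P}_x[\hat\tau_1(y)<\infty]=\frac{a(x)+a(y)-a(x-y)}{2a(x)}.$$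 -/

import Mathlib

open Filter Topology MeasureTheory ProbabilityTheory

noncomputable section

namespace PlanarWalk

/-- The square lattice `ℤ²`. -/
abbrev Z2 : Type := ℤ × ℤ

/-- `x ∼ y`: the sites `x` and `y` are neighbours in `ℤ²`. -/
def Nbr (x y : Z2) : Prop := |x.1 - y.1| + |x.2 - y.2| = 1

open Classical in
/-- Transition matrix of the two-dimensional simple random walk. -/
def srwP (x y : Z2) : ℝ := if Nbr x y then 1 / 4 else 0

open Classical in
/-- `k`-step transition probabilities of a transition matrix (for the matrices used here all
rows are finitely supported, so the sum is a finite one). -/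
def kStep (Q : Z2 → Z2 → ℝ) : ℕ → Z2 → Z2 → ℝ
  | 0, x, y => if x = y then 1 else 0
  | k + 1, x, y => ∑' z, Q x z * kStep Q k z y

/-- Partial sums `∑_{k < n} (ℙ₀[S_k = 0] - ℙ_x[S_k = 0])` of the series that defines the
potential kernel of the simple random walk. -/
def potentialPartial (x : Z2) (n : ℕ) : ℝ :=
  ∑ k ∈ Finset.range n, (kStep srwP k 0 0 - kStep srwP k x 0)

/-- The potential kernel `a(x) = ∑_{k ≥ 0} (ℙ₀[S_k = 0] - ℙ_x[S_k = 0])`. The series is in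
general only conditionally convergent, so it is the limit of its partial sums. -/
def potentialKernel (x : Z2) : ℝ := limUnder atTop (potentialPartial x)

open Classical in
/-- Transition matrix of the conditioned walk:
`a(y) / (4 a(x))` if `x ∼ y` and `x ≠ 0`, and `0` otherwise. -/
def condP (x y : Z2) : ℝ :=
  if Nbr x y ∧ x ≠ 0 then potentialKernel y / (4 * potentialKernel x) else 0

/-- Under the probability measure `P`, the process `S` is a Markov chain on `ℤ²` that starts at
`x` and has the transition matrix `Q`; equivalently, its finite-dimensional distributions are
`P[S₀ = p₀, …, Sₙ = pₙ] = 𝟙{p₀ = x} Q(p₀, p₁) ⋯ Q(pₙ₋₁, pₙ)`. -/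
structure IsChainFrom (Q : Z2 → Z2 → ℝ) (x : Z2) {Ω : Type*} [MeasurableSpace Ω]
    (P : Measure Ω) (S : ℕ → Ω → Z2) : Prop where
  measurable : ∀ n, Measurable (S n)
  fdd : ∀ (n : ℕ) (p : ℕ → Z2),
    P.real {ω | ∀ i ≤ n, S i ω = p i} =
      (open Classical in if p 0 = x then 1 else 0) * ∏ i ∈ Finset.range n, Q (p i) (p (i + 1))

/-- `m` is a reversible measure for the transition matrix `Q` on the state space `D`: it is
positive on `D` and satisfies the detailed balance equations. -/
structure IsReversibleOn (D : Set Z2) (Q : Z2 → Z2 → ℝ) (m : Z2 → ℝ) : Prop where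
  pos : ∀ x ∈ D, 0 < m x
  balance : ∀ x ∈ D, ∀ y ∈ D, m x * Q x y = m y * Q y x

/-- `Q` is, on the state space `D`, the transition matrix of the random walk on `ℤ²` with the
conductances `c(x, y)`, `x ∼ y`: `c` is symmetric and nonnegative on edges, and from a site
`x ∈ D` the walk jumps along an edge with probability proportional to its conductance (the
total conductance of the edges at `x` being positive), and only along edges. -/
structure IsConductanceWalkOn (D : Set Z2) (Q : Z2 → Z2 → ℝ) (c : Z2 → Z2 → ℝ) : Prop where
  symm : ∀ x y, Nbr x y → c x y = c y x
  nonneg : ∀ x y, Nbr x y → 0 ≤ c x y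
  total_pos : ∀ x ∈ D, 0 < ∑ᶠ (z) (_ : Nbr x z), c x z
  edge : ∀ x ∈ D, ∀ y, Nbr x y → Q x y = c x y / ∑ᶠ (z) (_ : Nbr x z), c x z
  not_edge : ∀ x ∈ D, ∀ y, ¬ Nbr x y → Q x y = 0

/-- Entrance time `inf {k ≥ 0 : S_k ∈ A}`, equal to `⊤` if there is no such `k`. -/
def entranceTime {Ω : Type*} (S : ℕ → Ω → Z2) (A : Set Z2) : Ω → WithTop ℕ :=
  hittingAfter S A 0

/-- Hitting time `inf {k ≥ 1 : S_k ∈ A}`, equal to `⊤` if there is no such `k`. -/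
def hitTime {Ω : Type*} (S : ℕ → Ω → Z2) (A : Set Z2) : Ω → WithTop ℕ :=
  hittingAfter S A 1

end PlanarWalk

end

/-!
Write `a` for the potential kernel. All analytic input comes from the discounted Green functions
`discGreen l`, `l < 1`, of the simple random walk. A maximum principle on the whole lattice gives
`discGreen l (x - y) * discGreen l y ≤ discGreen l x * discGreen l 0` (`discGreen_mul_le`), which
makes the differences `discKernel l x = discGreen l 0 - discGreen l x` subadditive in `x`. They are
at most `4` at the neighbours of the origin, hence bounded as `l → 1` for each fixed `x`. If the
coordinates of `x` have even sum, the terms of the series for `a x` are nonnegative, so that this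
bound yields convergence; for the other sites one averages over neighbours, using that
`ℙ₀[Sₙ = 0] → 0`. By Abel's theorem `a` inherits the subadditivity. It is positive and harmonic off
the origin, and its average over the neighbours of the origin is `1`. Reversibility, the description
by conductances and the martingale property of `1 / a` follow from these identities.

The recurrence of the planar walk enters through a maximum principle for functions on `ℤ²` that are
bounded above and subharmonic off the origin and one more site (`nonpos_of_le_nbrMean`). It is
proved with an explicit function, the logarithm of `|x|² - 1/2`, that is superharmonic off the
origin and tends to infinity.

For the conditioned walk put `f z = a z + a y - a (z - y)`, which is nonnegative and bounded by
subadditivity, and harmonic off the origin and `y`. The function `a y * f / a` exceeds its image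
under the transition operator of the conditioned walk by the indicator of `y`
(`condGreen_eq`); therefore the expected number of visits to `y` is finite, and transience follows
from the Borel–Cantelli lemma. The probability of hitting `y`, multiplied by `a`, is a bounded
function that is harmonic off the origin and `y`, vanishes at the origin, and has the value `a y` at
`y`. The maximum principle identifies it with `f / 2` (`tendsto_killedHit`).
-/

namespace PlanarWalk

/-! ### Neighbours and averages -/

lemma nbr_iff (x z : Z2) :
    Nbr x z ↔ z = x + (1, 0) ∨ z = x - (1, 0) ∨ z = x + (0, 1) ∨ z = x - (0, 1) := by
  obtain ⟨x1, x2⟩ := x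
  obtain ⟨z1, z2⟩ := z
  simp only [Nbr, Prod.mk_add_mk, Prod.mk_sub_mk, Prod.mk.injEq]
  rcases abs_cases (x1 - z1) with h | h <;> rcases abs_cases (x2 - z2) with h' | h' <;> omega

lemma nbr_comm (x y : Z2) : Nbr x y ↔ Nbr y x := by
  simp only [Nbr, abs_sub_comm]

/-- The four neighbours of `x`. -/
def nbrs (x : Z2) : Finset Z2 := {x + (1, 0), x - (1, 0), x + (0, 1), x - (0, 1)}

lemma mem_nbrs {x z : Z2} : z ∈ nbrs x ↔ Nbr x z := by
  simp [nbrs, nbr_iff]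

lemma sum_nbrs {M : Type*} [AddCommMonoid M] (f : Z2 → M) (x : Z2) :
    ∑ z ∈ nbrs x, f z = f (x + (1, 0)) + f (x - (1, 0)) + f (x + (0, 1)) + f (x - (0, 1)) := by
  obtain ⟨x1, x2⟩ := x
  rw [nbrs, Finset.sum_insert, Finset.sum_insert, Finset.sum_insert, Finset.sum_singleton]
  · simp only [add_assoc]
  all_goals simp
  all_goals omega

/-- The average of `f` over the four neighbours of `x`. -/
noncomputable def nbrMean (f : Z2 → ℝ) (x : Z2) : ℝ :=
  (f (x + (1, 0)) + f (x - (1, 0)) + f (x + (0, 1)) + f (x - (0, 1))) / 4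

lemma nbrMean_eq_sum (f : Z2 → ℝ) (x : Z2) : nbrMean f x = (∑ z ∈ nbrs x, f z) / 4 := by
  rw [sum_nbrs, nbrMean]

lemma nbrMean_congr {f g : Z2 → ℝ} {x : Z2} (h : ∀ z, Nbr x z → f z = g z) :
    nbrMean f x = nbrMean g x := by
  rw [nbrMean_eq_sum, nbrMean_eq_sum, Finset.sum_congr rfl fun z hz => h z (mem_nbrs.1 hz)]

lemma nbrMean_mono {f g : Z2 → ℝ} {x : Z2} (h : ∀ z, f z ≤ g z) :
    nbrMean f x ≤ nbrMean g x := by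
  rw [nbrMean_eq_sum, nbrMean_eq_sum]
  gcongr
  exact h _

lemma nbrMean_nonneg {f : Z2 → ℝ} (h : ∀ z, 0 ≤ f z) (x : Z2) : 0 ≤ nbrMean f x := by
  rw [nbrMean_eq_sum]
  exact div_nonneg (Finset.sum_nonneg fun z _ => h z) (by norm_num)

lemma tendsto_nbrMean {ι : Type*} {l : Filter ι} {f : ι → Z2 → ℝ} {g : Z2 → ℝ}
    (h : ∀ z, Tendsto (fun i => f i z) l (𝓝 (g z))) (x : Z2) :
    Tendsto (fun i => nbrMean (f i) x) l (𝓝 (nbrMean g x)) :=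
  ((((h _).add (h _)).add (h _)).add (h _)).div_const 4

/-! ### Return probabilities of the simple random walk -/

/-- The probability that the simple random walk from `x` is at the origin at time `k`. -/
noncomputable def returnProb (k : ℕ) (x : Z2) : ℝ := kStep srwP k x 0

lemma returnProb_zero (x : Z2) : returnProb 0 x = if x = 0 then 1 else 0 := by
  simp [returnProb, kStep]

lemma returnProb_succ (k : ℕ) (x : Z2) :
    returnProb (k + 1) x = nbrMean (returnProb k) x := by
  rw [returnProb, kStep, tsum_eq_sum (s := nbrs x)]
  · rw [nbrMean_eq_sum, Finset.sum_div]
    refine Finset.sum_congr rfl fun z hz => ?_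
    rw [srwP, if_pos (mem_nbrs.1 hz), returnProb]
    ring
  · intro z hz
    rw [srwP, if_neg (fun h => hz (mem_nbrs.2 h)), zero_mul]

lemma returnProb_nonneg (k : ℕ) : ∀ x, 0 ≤ returnProb k x := by
  induction k with
  | zero => intro x; rw [returnProb_zero]; split_ifs <;> norm_num
  | succ k ih => intro x; rw [returnProb_succ]; exact nbrMean_nonneg ih x

lemma returnProb_neg (k : ℕ) : ∀ x, returnProb k (-x) = returnProb k x := by
  induction k with
  | zero => intro x; simp [returnProb_zero]
  | succ k ih =>
    intro x
    have h1 := ih (x - (1, 0))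
    have h2 := ih (x + (1, 0))
    have h3 := ih (x - (0, 1))
    have h4 := ih (x + (0, 1))
    rw [neg_sub'] at h1 h3
    rw [neg_add'] at h2 h4
    simp only [sub_neg_eq_add] at h1 h3
    simp only [returnProb_succ, nbrMean, h1, h2, h3, h4]
    ring

lemma sum_returnProb_le_one (k : ℕ) : ∀ s : Finset Z2, ∑ x ∈ s, returnProb k x ≤ 1 := by
  induction k with
  | zero =>
    intro s
    simp only [returnProb_zero, Finset.sum_ite_eq']
    split_ifs <;> norm_num
  | succ k ih =>
    intro s
    have shift (v : Z2) : ∑ x ∈ s, returnProb k (x + v) ≤ 1 := by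
      simpa using ih (s.map (Equiv.addRight v).toEmbedding)
    have h1 := shift (1, 0)
    have h2 := shift (-(1, 0))
    have h3 := shift (0, 1)
    have h4 := shift (-(0, 1))
    simp only [← sub_eq_add_neg] at h2 h4
    simp only [returnProb_succ, nbrMean, ← Finset.sum_div, Finset.sum_add_distrib]
    linarith

lemma returnProb_le_one (k : ℕ) (x : Z2) : returnProb k x ≤ 1 := by
  simpa using sum_returnProb_le_one k {x}

lemma returnProb_eq_zero_of_odd (k : ℕ) : ∀ x : Z2, Odd ((k : ℤ) + x.1 + x.2) →
    returnProb k x = 0 := by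
  induction k with
  | zero =>
    rintro ⟨x1, x2⟩ h
    rw [returnProb_zero, if_neg]
    intro h0
    simp only [Prod.mk_eq_zero] at h0
    simp [h0.1, h0.2] at h
  | succ k ih =>
    rintro ⟨x1, x2⟩ ⟨m, hm⟩
    push_cast at hm
    rw [returnProb_succ, nbrMean, ih, ih, ih, ih]
    · simp
    · exact ⟨m - 1, by simp; omega⟩
    · exact ⟨m, by simp; omega⟩
    · exact ⟨m - 1, by simp; omega⟩
    · exact ⟨m, by simp; omega⟩

/-- Chapman–Kolmogorov equations. -/
lemma hasSum_returnProb_mul (j k : ℕ) : ∀ x,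
    HasSum (fun z => returnProb j z * returnProb k (x - z)) (returnProb (j + k) x) := by
  induction j with
  | zero =>
    intro x
    convert hasSum_ite_eq (0 : Z2) (returnProb k x) using 2 with z
    · rw [returnProb_zero]
      split_ifs with h <;> simp [h]
    · simp
  | succ j ih =>
    intro x
    have shift (v : Z2) : HasSum (fun z => returnProb j (z + v) * returnProb k (x - z))
        (returnProb (j + k) (x + v)) := by
      rw [← (Equiv.addRight (-v)).hasSum_iff]
      convert ih (x + v) using 2 with z
      simp [sub_eq_add_neg, add_assoc, add_comm]
    have h1 := shift (1, 0)
    have h2 := shift (-(1, 0))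
    have h3 := shift (0, 1)
    have h4 := shift (-(0, 1))
    simp only [← sub_eq_add_neg] at h2 h4
    have h := (((h1.add h2).add h3).add h4).div_const 4
    rw [show j + 1 + k = j + k + 1 by ring, returnProb_succ]
    refine (congrArg (HasSum · _) (funext fun z => ?_)).mpr h
    rw [returnProb_succ, nbrMean]
    ring

/-- At even times the walk is most likely to be where it started: by the Chapman–Kolmogorov
equations and the inequality `2bc ≤ b² + c²`. -/
lemma returnProb_even_le (j : ℕ) (x : Z2) : returnProb (j + j) x ≤ returnProb (j + j) 0 := by
  have h0 : HasSum (fun z => returnProb j z ^ 2) (returnProb (j + j) 0) := by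
    convert hasSum_returnProb_mul j j 0 using 2 with z
    rw [zero_sub, returnProb_neg, sq]
  have h1 : HasSum (fun z => returnProb j (x - z) ^ 2) (returnProb (j + j) 0) := by
    rw [← (Equiv.subLeft x).hasSum_iff]
    convert h0 using 2 with z
    simp
  have h2 := hasSum_le (fun z => ?_) (hasSum_returnProb_mul j j x) ((h0.add h1).div_const 2)
  · linarith
  · nlinarith [sq_nonneg (returnProb j z - returnProb j (x - z))]

/-! ### The discounted Green function -/

/-- The Green function `∑ₖ lᵏ ℙₓ[Sₖ = 0]` of the simple random walk killed at rate `1 - l`. -/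
noncomputable def discGreen (l : ℝ) (x : Z2) : ℝ := ∑' k, returnProb k x * l ^ k

variable {l : ℝ}

lemma summable_discGreen (h0 : 0 < l) (h1 : l < 1) (x : Z2) :
    Summable fun k => returnProb k x * l ^ k := by
  refine Summable.of_nonneg_of_le
    (fun k => mul_nonneg (returnProb_nonneg k x) (pow_nonneg h0.le k)) (fun k => ?_)
    (summable_geometric_of_lt_one h0.le h1)
  exact mul_le_of_le_one_left (pow_nonneg h0.le k) (returnProb_le_one k x)

lemma discGreen_nonneg (h0 : 0 < l) (x : Z2) : 0 ≤ discGreen l x :=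
  tsum_nonneg fun k => mul_nonneg (returnProb_nonneg k x) (pow_nonneg h0.le k)

lemma discGreen_le (h0 : 0 < l) (h1 : l < 1) (x : Z2) : discGreen l x ≤ (1 - l)⁻¹ := by
  rw [← tsum_geometric_of_lt_one h0.le h1]
  exact (summable_discGreen h0 h1 x).tsum_le_tsum
    (fun k => mul_le_of_le_one_left (pow_nonneg h0.le k) (returnProb_le_one k x))
    (summable_geometric_of_lt_one h0.le h1)

lemma discGreen_neg (x : Z2) : discGreen l (-x) = discGreen l x := by
  simp only [discGreen, returnProb_neg]

lemma discGreen_eq (h0 : 0 < l) (h1 : l < 1) (x : Z2) :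
    discGreen l x = (if x = 0 then 1 else 0) + l * nbrMean (discGreen l) x := by
  rw [discGreen, (summable_discGreen h0 h1 x).tsum_eq_zero_add, returnProb_zero, pow_zero, mul_one]
  congr 1
  have hs (z : Z2) : HasSum (fun k => returnProb k z * l ^ k) (discGreen l z) :=
    (summable_discGreen h0 h1 z).hasSum
  refine HasSum.tsum_eq ?_
  refine (congrArg (HasSum · _) (funext fun k => ?_)).mpr
    (((((hs (x + (1, 0))).add (hs (x - (1, 0)))).add (hs (x + (0, 1)))).add
      (hs (x - (0, 1)))).div_const 4 |>.mul_left l)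
  rw [returnProb_succ, nbrMean, pow_succ]
  ring

lemma one_le_discGreen_zero (h0 : 0 < l) (h1 : l < 1) : 1 ≤ discGreen l 0 := by
  rw [discGreen_eq h0 h1, if_pos rfl]
  have := nbrMean_nonneg (discGreen_nonneg h0) 0
  nlinarith

/-- Going to the origin by way of `y` is harder than going there directly. As a function of `x`
the difference of the two sides vanishes at `y` and satisfies `l * nbrMean u x ≤ u x` elsewhere,
so that its infimum `m` satisfies `l * m ≤ m`. -/
lemma discGreen_mul_le (h0 : 0 < l) (h1 : l < 1) (x y : Z2) :
    discGreen l (x - y) * discGreen l y ≤ discGreen l x * discGreen l 0 := by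
  set G := discGreen l
  set u : Z2 → ℝ := fun x => G x * G 0 - G (x - y) * G y with hu
  have hG := discGreen_nonneg (l := l) h0
  have hbdd : BddBelow (Set.range u) := by
    refine ⟨-((1 - l)⁻¹ * (1 - l)⁻¹), ?_⟩
    rintro _ ⟨z, rfl⟩
    have h2 : G (z - y) * G y ≤ (1 - l)⁻¹ * (1 - l)⁻¹ :=
      mul_le_mul (discGreen_le h0 h1 _) (discGreen_le h0 h1 _) (hG _)
        (inv_nonneg.2 (by linarith))
    have h3 : 0 ≤ G z * G 0 := mul_nonneg (hG _) (hG _)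
    simp only [hu]
    linarith
  have hm (z : Z2) : ⨅ w, u w ≤ u z := ciInf_le hbdd z
  have hy : u y = 0 := by simp only [hu, sub_self]; ring
  have hstep (z : Z2) : l * ⨅ w, u w ≤ u z := by
    by_cases hz : z = y
    · rw [hz, hy]
      have := hm y
      rw [hy] at this
      nlinarith
    · have e1 := discGreen_eq h0 h1 z
      have e2 := discGreen_eq h0 h1 (z - y)
      rw [if_neg (sub_ne_zero.2 hz), zero_add] at e2
      have hmean : u z = (if z = 0 then 1 else 0) * G 0 + l * nbrMean u z := by
        change G z = _ at e1
        change G (z - y) = _ at e2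
        simp only [hu]
        rw [e1, e2]
        simp only [nbrMean, G, sub_add_eq_add_sub, sub_right_comm z y]
        ring
      have hinf : ⨅ w, u w ≤ nbrMean u z := by
        rw [nbrMean]
        linarith [hm (z + (1, 0)), hm (z - (1, 0)), hm (z + (0, 1)), hm (z - (0, 1))]
      have hd : 0 ≤ (if z = 0 then 1 else 0) * G 0 := by
        have := hG 0
        split_ifs <;> simp [this, G]
      rw [hmean]
      nlinarith [mul_le_mul_of_nonneg_left hinf h0.le]
  have hl : l * ⨅ w, u w ≤ ⨅ w, u w := le_ciInf hstep
  have hpos : 0 ≤ ⨅ w, u w := by nlinarith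
  have := hm x
  simp only [hu] at this hpos
  linarith

/-- The discounted potential kernel. -/
noncomputable def discKernel (l : ℝ) (x : Z2) : ℝ := discGreen l 0 - discGreen l x

lemma discKernel_neg (x : Z2) : discKernel l (-x) = discKernel l x := by
  rw [discKernel, discGreen_neg, discKernel]

lemma discKernel_nonneg (h0 : 0 < l) (h1 : l < 1) (x : Z2) : 0 ≤ discKernel l x := by
  have h := discGreen_mul_le h0 h1 0 x
  rw [zero_sub, discGreen_neg] at h
  exact sub_nonneg.2 (le_of_sq_le_sq (by simpa only [sq] using h) (discGreen_nonneg h0 0))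

lemma discKernel_add_le (h0 : 0 < l) (h1 : l < 1) (x y : Z2) :
    discKernel l (x + y) ≤ discKernel l x + discKernel l y := by
  have h := discGreen_mul_le h0 h1 (x + y) y
  rw [add_sub_cancel_right] at h
  have hx := discKernel_nonneg h0 h1 x
  have hy := discKernel_nonneg h0 h1 y
  have hG := one_le_discGreen_zero h0 h1
  simp only [discKernel] at *
  have := mul_nonneg hx hy
  nlinarith

lemma discKernel_le_four (h0 : 0 < l) (h1 : l < 1) {e : Z2} (he : Nbr 0 e) :
    discKernel l e ≤ 4 := by
  have hG := discGreen_eq h0 h1 0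
  rw [if_pos rfl] at hG
  have h1G := one_le_discGreen_zero h0 h1
  have hmean : nbrMean (discKernel l) 0 ≤ 1 := by
    have : nbrMean (discKernel l) 0 = discGreen l 0 - nbrMean (discGreen l) 0 := by
      simp only [nbrMean, discKernel]; ring
    rw [this]
    nlinarith
  have hle : discKernel l e ≤ ∑ z ∈ nbrs 0, discKernel l z :=
    Finset.single_le_sum (fun z _ => discKernel_nonneg h0 h1 z) (mem_nbrs.2 he)
  rw [nbrMean_eq_sum] at hmean
  linarith

/-- By subadditivity, the points at which the discounted potential kernels are bounded form a
group; it contains the neighbours of the origin. -/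
lemma exists_discKernel_le (x : Z2) : ∃ C, ∀ l : ℝ, 0 < l → l < 1 → discKernel l x ≤ C := by
  let H : AddSubgroup Z2 :=
    { carrier := {x | ∃ C, ∀ l : ℝ, 0 < l → l < 1 → discKernel l x ≤ C}
      zero_mem' := ⟨0, fun l _ _ => by simp [discKernel]⟩
      add_mem' := by
        rintro x y ⟨C, hC⟩ ⟨D, hD⟩
        exact ⟨C + D, fun l h0 h1 =>
          (discKernel_add_le h0 h1 x y).trans (add_le_add (hC l h0 h1) (hD l h0 h1))⟩
      neg_mem' := by
        rintro x ⟨C, hC⟩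
        exact ⟨C, fun l h0 h1 => by rw [discKernel_neg]; exact hC l h0 h1⟩ }
  have e1 : ((1, 0) : Z2) ∈ H := ⟨4, fun l h0 h1 => discKernel_le_four h0 h1 (by simp [Nbr])⟩
  have e2 : ((0, 1) : Z2) ∈ H := ⟨4, fun l h0 h1 => discKernel_le_four h0 h1 (by simp [Nbr])⟩
  have hx : x = x.1 • ((1, 0) : Z2) + x.2 • ((0, 1) : Z2) := by ext <;> simp
  have : x ∈ H := by
    rw [hx]
    exact H.add_mem (H.zsmul_mem e1 _) (H.zsmul_mem e2 _)
  exact this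

/-! ### Convergence of the series -/

lemma potentialPartial_eq (x : Z2) (n : ℕ) :
    potentialPartial x n = ∑ k ∈ Finset.range n, (returnProb k 0 - returnProb k x) := rfl

lemma hasSum_discKernel (h0 : 0 < l) (h1 : l < 1) (x : Z2) :
    HasSum (fun k => (returnProb k 0 - returnProb k x) * l ^ k) (discKernel l x) := by
  refine (congrArg (HasSum · _) (funext fun k => ?_)).mpr
    ((summable_discGreen h0 h1 0).hasSum.sub (summable_discGreen h0 h1 x).hasSum)
  ring

lemma returnProb_le_of_even {x : Z2} (hx : Even (x.1 + x.2)) (k : ℕ) :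
    0 ≤ returnProb k 0 - returnProb k x := by
  rcases Nat.even_or_odd k with ⟨j, rfl⟩ | hk
  · exact sub_nonneg.2 (returnProb_even_le j x)
  · rw [returnProb_eq_zero_of_odd k x, sub_zero]
    · exact returnProb_nonneg k 0
    · rw [add_assoc]
      exact ((Int.odd_coe_nat k).2 hk).add_even hx

lemma monotone_potentialPartial {x : Z2} (hx : Even (x.1 + x.2)) :
    Monotone (potentialPartial x) := by
  refine monotone_nat_of_le_succ fun n => ?_
  rw [potentialPartial_eq, potentialPartial_eq, Finset.sum_range_succ]
  linarith [returnProb_le_of_even hx n]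

lemma bddAbove_potentialPartial {x : Z2} (hx : Even (x.1 + x.2)) :
    BddAbove (Set.range (potentialPartial x)) := by
  obtain ⟨C, hC⟩ := exists_discKernel_le x
  refine ⟨C, ?_⟩
  rintro _ ⟨n, rfl⟩
  have hlim : Tendsto (fun l : ℝ => ∑ k ∈ Finset.range n, (returnProb k 0 - returnProb k x) * l ^ k)
      (𝓝[<] 1) (𝓝 (potentialPartial x n)) := by
    have hc : Continuous fun l : ℝ =>
        ∑ k ∈ Finset.range n, (returnProb k 0 - returnProb k x) * l ^ k := by fun_prop
    have := hc.tendsto 1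
    simp only [one_pow, mul_one] at this
    exact this.mono_left nhdsWithin_le_nhds
  refine le_of_tendsto hlim ?_
  filter_upwards [Ioo_mem_nhdsLT (show (0 : ℝ) < 1 by norm_num)] with l hl
  refine le_trans ?_ (hC l hl.1 hl.2)
  exact sum_le_hasSum _ (fun k _ => mul_nonneg (returnProb_le_of_even hx k)
    (pow_nonneg hl.1.le k)) (hasSum_discKernel hl.1 hl.2 x)

lemma exists_tendsto_of_even {x : Z2} (hx : Even (x.1 + x.2)) :
    ∃ b, Tendsto (potentialPartial x) atTop (𝓝 b) :=
  ⟨_, tendsto_atTop_ciSup (monotone_potentialPartial hx) (bddAbove_potentialPartial hx)⟩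

/-- For even `x` the terms of the series tend to `0`, so that for each `K` the walk is nearly
equally likely to be at the origin and at each of `K` other sites; the probability of being at
the origin is thus asymptotically at most `1 / K`. -/
lemma tendsto_returnProb_zero : Tendsto (fun n => returnProb n 0) atTop (𝓝 0) := by
  have hterm (i : ℕ) :
      Tendsto (fun n => returnProb n 0 - returnProb n (2 * (i : ℤ), 0)) atTop (𝓝 0) := by
    obtain ⟨b, hb⟩ := exists_tendsto_of_even (x := (2 * (i : ℤ), 0)) (by simp)
    have := (hb.comp (tendsto_add_atTop_nat 1)).sub hb
    rw [sub_self] at this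
    refine this.congr fun n => ?_
    rw [Function.comp_apply, potentialPartial_eq, potentialPartial_eq, Finset.sum_range_succ]
    ring
  rw [Metric.tendsto_atTop]
  intro ε hε
  obtain ⟨K, hK⟩ := exists_nat_gt (2 / ε)
  have hKpos : (0 : ℝ) < K := lt_trans (by positivity) hK
  have hsum : Tendsto (fun n => ∑ i ∈ Finset.range K,
      (returnProb n 0 - returnProb n (2 * (i : ℤ), 0))) atTop (𝓝 0) := by
    simpa using tendsto_finsetSum (Finset.range K) fun i _ => hterm i
  obtain ⟨N, hN⟩ := (hsum.eventually (gt_mem_nhds (show (0 : ℝ) < 1 by norm_num))).exists_forall_of_atTop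
  refine ⟨N, fun n hn => ?_⟩
  have h1 := hN n hn
  have h2 : ∑ i ∈ Finset.range K, returnProb n (2 * (i : ℤ), 0) ≤ 1 := by
    have := sum_returnProb_le_one n ((Finset.range K).map
      ⟨fun i : ℕ => ((2 * (i : ℤ), 0) : Z2), fun i j h => by simpa using h⟩)
    rwa [Finset.sum_map] at this
  rw [Finset.sum_sub_distrib, Finset.sum_const, Finset.card_range, nsmul_eq_mul] at h1
  rw [Real.dist_eq, sub_zero, abs_of_nonneg (returnProb_nonneg n 0)]
  rw [div_lt_iff₀ hε] at hK
  by_contra! hcon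
  nlinarith

lemma potentialPartial_succ {x : Z2} (hx : x ≠ 0) (n : ℕ) :
    potentialPartial x (n + 1) =
      returnProb n 0 + nbrMean (fun z => potentialPartial z n) x := by
  simp only [nbrMean, potentialPartial_eq]
  rw [Finset.sum_sub_distrib, Finset.sum_range_succ, Finset.sum_range_succ' (fun k => returnProb k x),
    returnProb_zero, if_neg hx]
  simp only [returnProb_succ, nbrMean, Finset.sum_sub_distrib, ← Finset.sum_div,
    Finset.sum_add_distrib]
  ring

lemma nbrMean_potentialPartial_zero (n : ℕ) :
    nbrMean (fun z => potentialPartial z n) 0 = 1 - returnProb n 0 := by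
  have h := Finset.sum_range_succ' (fun k => returnProb k 0) n
  rw [Finset.sum_range_succ, returnProb_zero, if_pos rfl] at h
  simp only [returnProb_succ, nbrMean, ← Finset.sum_div, Finset.sum_add_distrib] at h
  simp only [nbrMean, potentialPartial_eq, Finset.sum_sub_distrib]
  linarith

lemma even_add_of_nbr {x z : Z2} (hx : ¬ Even (x.1 + x.2)) (h : Nbr x z) :
    Even (z.1 + z.2) := by
  obtain ⟨m, hm⟩ := Int.not_even_iff_odd.1 hx
  rcases (nbr_iff x z).1 h with rfl | rfl | rfl | rfl
  · exact ⟨m + 1, by simp; omega⟩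
  · exact ⟨m, by simp; omega⟩
  · exact ⟨m + 1, by simp; omega⟩
  · exact ⟨m, by simp; omega⟩

theorem tendsto_potentialPartial (x : Z2) :
    Tendsto (potentialPartial x) atTop (𝓝 (potentialKernel x)) := by
  refine tendsto_nhds_limUnder ?_
  by_cases hx : Even (x.1 + x.2)
  · exact exists_tendsto_of_even hx
  · have hx0 : x ≠ 0 := by
      rintro rfl
      simp at hx
    have ex (z : Z2) (hz : Nbr x z) := exists_tendsto_of_even (even_add_of_nbr hx hz)
    obtain ⟨b1, h1⟩ := ex (x + (1, 0)) ((nbr_iff _ _).2 (by simp))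
    obtain ⟨b2, h2⟩ := ex (x - (1, 0)) ((nbr_iff _ _).2 (by simp))
    obtain ⟨b3, h3⟩ := ex (x + (0, 1)) ((nbr_iff _ _).2 (by simp))
    obtain ⟨b4, h4⟩ := ex (x - (0, 1)) ((nbr_iff _ _).2 (by simp))
    have h := tendsto_returnProb_zero.add ((((h1.add h2).add h3).add h4).div_const 4)
    refine ⟨_, (tendsto_add_atTop_iff_nat 1).1 (h.congr fun n => ?_)⟩
    rw [potentialPartial_succ hx0, nbrMean]

/-! ### Properties of the potential kernel -/

lemma potentialKernel_zero : potentialKernel 0 = 0 := by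
  refine tendsto_nhds_unique (tendsto_potentialPartial 0) (tendsto_const_nhds.congr fun n => ?_)
  simp [potentialPartial_eq]

lemma nbrMean_potentialKernel {x : Z2} (hx : x ≠ 0) :
    nbrMean potentialKernel x = potentialKernel x := by
  have h := tendsto_returnProb_zero.add (tendsto_nbrMean tendsto_potentialPartial x)
  rw [zero_add] at h
  refine tendsto_nhds_unique h ?_
  refine ((tendsto_add_atTop_iff_nat 1).2 (tendsto_potentialPartial x)).congr fun n => ?_
  rw [potentialPartial_succ hx]

lemma nbrMean_potentialKernel_zero : nbrMean potentialKernel 0 = 1 := by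
  refine tendsto_nhds_unique (tendsto_nbrMean tendsto_potentialPartial 0) ?_
  refine Tendsto.congr (fun n => (nbrMean_potentialPartial_zero n).symm) ?_
  simpa using tendsto_returnProb_zero.const_sub 1

lemma one_le_potentialKernel_of_even {x : Z2} (hx : Even (x.1 + x.2)) (hx0 : x ≠ 0) :
    1 ≤ potentialKernel x := by
  refine le_trans ?_ ((monotone_potentialPartial hx).ge_of_tendsto (tendsto_potentialPartial x) 1)
  simp [potentialPartial_eq, returnProb_zero, hx0]

lemma tendsto_discKernel (x : Z2) :
    Tendsto (fun l => discKernel l x) (𝓝[<] 1) (𝓝 (potentialKernel x)) := by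
  refine (Real.tendsto_tsum_powerSeries_nhdsWithin_lt
    (f := fun k => returnProb k 0 - returnProb k x) (tendsto_potentialPartial x)).congr' ?_
  filter_upwards [Ioo_mem_nhdsLT (show (0 : ℝ) < 1 by norm_num)] with l hl
  exact (hasSum_discKernel hl.1 hl.2 x).tsum_eq

lemma potentialKernel_nonneg (x : Z2) : 0 ≤ potentialKernel x := by
  refine ge_of_tendsto (tendsto_discKernel x) ?_
  filter_upwards [Ioo_mem_nhdsLT (show (0 : ℝ) < 1 by norm_num)] with l hl
  exact discKernel_nonneg hl.1 hl.2 x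

lemma potentialKernel_neg (x : Z2) : potentialKernel (-x) = potentialKernel x := by
  have : potentialPartial (-x) = potentialPartial x := by
    ext n
    simp only [potentialPartial_eq, returnProb_neg]
  rw [potentialKernel, this, potentialKernel]

lemma potentialKernel_add_le (x y : Z2) :
    potentialKernel (x + y) ≤ potentialKernel x + potentialKernel y := by
  refine le_of_tendsto_of_tendsto (tendsto_discKernel _)
    ((tendsto_discKernel x).add (tendsto_discKernel y)) ?_
  filter_upwards [Ioo_mem_nhdsLT (show (0 : ℝ) < 1 by norm_num)] with l hl
  exact discKernel_add_le hl.1 hl.2 x y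

lemma potentialKernel_pos {x : Z2} (hx : x ≠ 0) : 0 < potentialKernel x := by
  by_cases he : Even (x.1 + x.2)
  · linarith [one_le_potentialKernel_of_even he hx]
  · rw [← nbrMean_potentialKernel hx, nbrMean]
    have h1 := potentialKernel_nonneg (x + (1, 0))
    have h2 := potentialKernel_nonneg (x - (1, 0))
    have h3 := potentialKernel_nonneg (x + (0, 1))
    have h4 := potentialKernel_nonneg (x - (0, 1))
    by_cases h : x + (1, 0) = 0
    · have h' : x - (1, 0) ≠ 0 := by
        rw [eq_neg_of_add_eq_zero_left h]
        simp
      have := one_le_potentialKernel_of_even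
        (even_add_of_nbr he ((nbr_iff x (x - (1, 0))).2 (by simp))) h'
      linarith
    · have := one_le_potentialKernel_of_even
        (even_add_of_nbr he ((nbr_iff x (x + (1, 0))).2 (by simp))) h
      linarith

lemma potentialKernel_ne_zero {x : Z2} (hx : x ≠ 0) : potentialKernel x ≠ 0 :=
  (potentialKernel_pos hx).ne'

/-! ### A maximum principle -/

/-- A function with `log (barrier x)` superharmonic off the origin and tending to infinity. The
shift by `1 / 2` makes the product of its values at the neighbours of `x` equal to
`barrier x ^ 4 - 4 * (x₁² - x₂²)²`, unless one of them is the origin. -/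
noncomputable def barrier (x : Z2) : ℝ :=
  if x = 0 then 1 / 128 else (x.1 : ℝ) ^ 2 + (x.2 : ℝ) ^ 2 - 1 / 2

lemma one_le_sq_add_sq {x : Z2} (hx : x ≠ 0) : (1 : ℝ) ≤ (x.1 : ℝ) ^ 2 + (x.2 : ℝ) ^ 2 := by
  have : (1 : ℤ) ≤ x.1 ^ 2 + x.2 ^ 2 := by
    by_contra! h
    have h1 : x.1 = 0 := by nlinarith [sq_nonneg x.1, sq_nonneg x.2]
    have h2 : x.2 = 0 := by nlinarith [sq_nonneg x.1, sq_nonneg x.2]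
    exact hx (Prod.ext h1 h2)
  exact_mod_cast this

lemma le_barrier (x : Z2) : 1 / 128 ≤ barrier x := by
  rw [barrier]
  split_ifs with h
  · exact le_rfl
  · linarith [one_le_sq_add_sq h]

lemma barrier_pos (x : Z2) : 0 < barrier x := lt_of_lt_of_le (by norm_num) (le_barrier x)

lemma sq_add_sq_le_barrier (x : Z2) : (x.1 : ℝ) ^ 2 + (x.2 : ℝ) ^ 2 ≤ barrier x + 1 / 2 := by
  rw [barrier]
  split_ifs with h
  · simp [h]; norm_num
  · linarith

lemma prod_barrier_le {x : Z2} (hx : x ≠ 0) :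
    barrier (x + (1, 0)) * barrier (x - (1, 0)) * barrier (x + (0, 1)) * barrier (x - (0, 1))
      ≤ barrier x ^ 4 := by
  by_cases hn : Nbr x 0
  · have := (nbr_iff 0 x).1 ((nbr_comm _ _).1 hn)
    rcases this with rfl | rfl | rfl | rfl <;> norm_num [barrier]
  · have h (z : Z2) (hz : Nbr x z) : barrier z = (z.1 : ℝ) ^ 2 + (z.2 : ℝ) ^ 2 - 1 / 2 := by
      rw [barrier, if_neg]
      rintro rfl
      exact hn hz
    rw [h _ ((nbr_iff _ _).2 (by simp)), h (x - (1, 0)) ((nbr_iff _ _).2 (by simp)),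
      h (x + (0, 1)) ((nbr_iff _ _).2 (by simp)), h (x - (0, 1)) ((nbr_iff _ _).2 (by simp)),
      barrier, if_neg hx]
    simp only [Prod.fst_add, Prod.snd_add, Prod.fst_sub, Prod.snd_sub, add_zero, sub_zero]
    push_cast
    have := sq_nonneg ((x.1 : ℝ) ^ 2 - (x.2 : ℝ) ^ 2)
    linear_combination 4 * this

lemma nbrMean_log_barrier_le {x : Z2} (hx : x ≠ 0) :
    nbrMean (fun z => Real.log (barrier z)) x ≤ Real.log (barrier x) := by
  have p := fun z => (barrier_pos z).ne'
  have h := Real.log_le_log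
    (mul_pos (mul_pos (mul_pos (barrier_pos _) (barrier_pos _)) (barrier_pos _)) (barrier_pos _))
    (prod_barrier_le hx)
  rw [Real.log_mul (mul_ne_zero (mul_ne_zero (p _) (p _)) (p _)) (p _),
    Real.log_mul (mul_ne_zero (p _) (p _)) (p _), Real.log_mul (p _) (p _), Real.log_pow] at h
  rw [nbrMean]
  push_cast at h
  linarith

lemma finite_setOf_log_barrier_le (c : ℝ) : {x : Z2 | Real.log (barrier x) ≤ c}.Finite := by
  obtain ⟨N, hN⟩ := exists_nat_gt (Real.exp c + 1 / 2)
  refine ((Set.finite_Icc (-(N : ℤ)) N).prod (Set.finite_Icc (-(N : ℤ)) N)).subset ?_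
  intro x hx
  have h1 := (Real.log_le_iff_le_exp (barrier_pos x)).1 hx
  have h2 : (x.1 : ℝ) ^ 2 + (x.2 : ℝ) ^ 2 < N := by linarith [sq_add_sq_le_barrier x]
  have h3 : x.1 ^ 2 + x.2 ^ 2 < (N : ℤ) := by exact_mod_cast h2
  have hsq (m : ℤ) (hm : m ^ 2 < (N : ℤ)) : m ∈ Set.Icc (-(N : ℤ)) N := by
    constructor <;> nlinarith [sq_nonneg (m + 1), sq_nonneg (m - 1)]
  exact ⟨hsq _ (by nlinarith [sq_nonneg x.2]), hsq _ (by nlinarith [sq_nonneg x.1])⟩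

/-- Maximum principle in the unbounded domain `ℤ² \ {0, y}`: this is where the recurrence of the
planar simple random walk enters. -/
theorem nonpos_of_le_nbrMean {g : Z2 → ℝ} {C : ℝ} {y : Z2} (hC : ∀ x, g x ≤ C) (h0 : g 0 ≤ 0)
    (hy : g y ≤ 0) (hg : ∀ x, x ≠ 0 → x ≠ y → g x ≤ nbrMean g x) (x₀ : Z2) : g x₀ ≤ 0 := by
  by_contra! hpos
  set w : Z2 → ℝ := fun x => Real.log (barrier x) - Real.log (1 / 128) with hw
  have hw0 (x : Z2) : 0 ≤ w x :=
    sub_nonneg.2 (Real.log_le_log (by norm_num) (le_barrier x))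
  obtain ⟨ε, hε, hεw⟩ : ∃ ε > 0, ε * w x₀ < g x₀ := by
    refine ⟨g x₀ / (w x₀ + 1), div_pos hpos (by linarith [hw0 x₀]), ?_⟩
    rw [div_mul_eq_mul_div, div_lt_iff₀ (by linarith [hw0 x₀])]
    nlinarith
  set φ : Z2 → ℝ := fun x => g x - ε * w x with hφ
  have hfin : {x | φ x₀ ≤ φ x}.Finite := by
    refine (finite_setOf_log_barrier_le ((C - φ x₀) / ε + Real.log (1 / 128))).subset ?_
    intro x hx
    have h1 : φ x₀ ≤ g x - ε * w x := hx
    have h2 : w x ≤ (C - φ x₀) / ε := by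
      rw [le_div_iff₀ hε]
      linarith [hC x]
    simp only [hw] at h2
    change Real.log (barrier x) ≤ _
    linarith
  obtain ⟨x₁, hx₁, hmax₁⟩ := hfin.exists_maximalFor φ _ ⟨x₀, le_refl (φ x₀)⟩
  have hle (x : Z2) : φ x ≤ φ x₁ := by
    by_cases hx : φ x₀ ≤ φ x
    · by_contra! h
      exact absurd (hmax₁ hx h.le) (not_le.2 h)
    · exact (not_le.1 hx).le.trans hx₁
  -- among the points where `φ` is maximal, the one farthest to the right
  have hfin' : {x | φ x₁ ≤ φ x}.Finite := hfin.subset fun x hx =>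
    le_trans (show φ x₀ ≤ φ x₁ from hx₁) hx
  obtain ⟨x₂, hx₂, hmax₂⟩ := hfin'.exists_maximalFor (fun x : Z2 => x.1) _ ⟨x₁, le_refl (φ x₁)⟩
  have hright : φ (x₂ + (1, 0)) < φ x₁ := by
    by_contra! h
    have := hmax₂ (j := x₂ + (1, 0)) h (by simp)
    simp at this
  have hφpos : 0 < φ x₂ := by
    have : φ x₀ ≤ φ x₂ := le_trans hx₁ hx₂
    simp only [hφ] at this ⊢
    linarith
  have hφg : φ x₂ ≤ g x₂ := by
    simp only [hφ]
    nlinarith [hw0 x₂]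
  have hne0 : x₂ ≠ 0 := by
    intro h
    rw [h] at hφg hφpos
    linarith
  have hney : x₂ ≠ y := by
    intro h
    rw [h] at hφg hφpos
    linarith
  have h1 := hg x₂ hne0 hney
  have h2 := mul_le_mul_of_nonneg_left (nbrMean_log_barrier_le hne0) hε.le
  have h3 : φ x₂ ≤ nbrMean φ x₂ := by
    simp only [nbrMean, hφ, hw] at h1 h2 ⊢
    linarith
  have h4 : φ x₁ ≤ φ x₂ := hx₂
  rw [nbrMean] at h3
  linarith [hle (x₂ - (1, 0)), hle (x₂ + (0, 1)), hle (x₂ - (0, 1))]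

/-! ### The Markov property -/

open scoped ENNReal

section Chain

variable {Q : Z2 → Z2 → ℝ} {x : Z2} {Ω : Type*} [MeasurableSpace Ω] {P : Measure Ω}
  {S : ℕ → Ω → Z2}

/-- The natural filtration of a chain. -/
abbrev IsChainFrom.filtration (hS : IsChainFrom Q x P S) : Filtration ℕ ‹MeasurableSpace Ω› :=
  Filtration.natural S (fun n => (hS.measurable n).stronglyMeasurable)

lemma IsChainFrom.measurableSet_filtration (hS : IsChainFrom Q x P S) {j n : ℕ} (hj : j ≤ n)
    (B : Set Z2) : MeasurableSet[hS.filtration n] {ω | S j ω ∈ B} := by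
  have h : MeasurableSet[MeasurableSpace.comap (S j) inferInstance] (S j ⁻¹' B) :=
    ⟨B, B.to_countable.measurableSet, rfl⟩
  exact (le_iSup₂_of_le (f := fun j (_ : j ≤ n) => MeasurableSpace.comap (S j) inferInstance)
    j hj le_rfl) _ h

/-- The event that the chain follows the path `p` up to time `n`. -/
def pathEvent (S : ℕ → Ω → Z2) (n : ℕ) (p : ℕ → Z2) : Set Ω := {ω | ∀ i ≤ n, S i ω = p i}

lemma IsChainFrom.measurableSet_pathEvent (hS : IsChainFrom Q x P S) (n : ℕ) (p : ℕ → Z2) :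
    MeasurableSet (pathEvent S n p) := by
  have : pathEvent S n p = ⋂ i, ⋂ (_ : i ≤ n), S i ⁻¹' {p i} := by
    ext ω
    simp [pathEvent]
  rw [this]
  exact MeasurableSet.iInter fun i => MeasurableSet.iInter fun _ =>
    hS.measurable i (measurableSet_singleton _)

/-- An event of the natural filtration at time `n` is a countable disjoint union of path events. -/
lemma IsChainFrom.exists_eq_iUnion_pathEvent (hS : IsChainFrom Q x P S) {n : ℕ} {A : Set Ω}
    (hA : MeasurableSet[hS.filtration n] A) :
    ∃ E : Set (Fin (n + 1) → Z2), Pairwise (Function.onFun Disjoint fun q : E =>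
      pathEvent S n fun i => q.1 (Fin.ofNat (n + 1) i)) ∧
      A = ⋃ q : E, pathEvent S n fun i => q.1 (Fin.ofNat (n + 1) i) := by
  let T : Ω → Fin (n + 1) → Z2 := fun ω i => S i ω
  have hle : hS.filtration n ≤ MeasurableSpace.comap T inferInstance := by
    refine iSup₂_le fun j hj => ?_
    have : S j = (fun q : Fin (n + 1) → Z2 => q ⟨j, Nat.lt_succ_of_le hj⟩) ∘ T := rfl
    rw [this, ← MeasurableSpace.comap_comp]
    exact MeasurableSpace.comap_mono (measurable_pi_apply _).comap_le
  obtain ⟨E, -, rfl⟩ := hle A hA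
  have hT (q : Fin (n + 1) → Z2) :
      pathEvent S n (fun i => q (Fin.ofNat (n + 1) i)) = T ⁻¹' {q} := by
    ext ω
    simp only [pathEvent, Set.mem_ofPred_eq, Set.mem_preimage, Set.mem_singleton_iff, T]
    constructor
    · intro h
      ext1 i
      have := h i (Nat.le_of_lt_succ i.2)
      simpa using this
    · rintro rfl i hi
      simp [Nat.mod_eq_of_lt (Nat.lt_succ_of_le hi)]
  refine ⟨E, ?_, ?_⟩
  · intro q q' hqq'
    simp only [Function.onFun, hT]
    exact Disjoint.preimage T (Set.disjoint_singleton.2 fun h => hqq' (Subtype.ext h))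
  · simp only [hT]
    rw [← Set.preimage_iUnion]
    simp

variable [IsProbabilityMeasure P]

lemma IsChainFrom.measure_pathEvent_inter (hS : IsChainFrom Q x P S)
    (n : ℕ) (p : ℕ → Z2) (z : Z2) :
    P (pathEvent S n p ∩ {ω | S (n + 1) ω = z}) =
      P (pathEvent S n p) * ENNReal.ofReal (Q (p n) z) := by
  classical
  have hset : pathEvent S n p ∩ {ω | S (n + 1) ω = z} =
      pathEvent S (n + 1) (Function.update p (n + 1) z) := by
    ext ω
    simp only [pathEvent, Set.mem_inter_iff, Set.mem_ofPred_eq]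
    constructor
    · rintro ⟨h, hz⟩ i hi
      rcases Nat.lt_or_eq_of_le hi with hi | rfl
      · rw [Function.update_of_ne hi.ne, h i (Nat.le_of_lt_succ hi)]
      · rw [Function.update_self, hz]
    · intro h
      refine ⟨fun i hi => ?_, ?_⟩
      · rw [h i (by omega), Function.update_of_ne (by omega)]
      · rw [h (n + 1) le_rfl, Function.update_self]
  have h1 := hS.fdd (n + 1) (Function.update p (n + 1) z)
  have h2 := hS.fdd n p
  rw [Finset.prod_range_succ, Function.update_self, Function.update_of_ne (by omega),
    Function.update_of_ne (by omega), ← mul_assoc,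
    Finset.prod_congr rfl (g := fun i => Q (p i) (p (i + 1))), ← h2] at h1
  · rw [hset, ← ENNReal.ofReal_toReal (measure_ne_top P (pathEvent S (n + 1) _)),
      ← ENNReal.ofReal_toReal (measure_ne_top P (pathEvent S n p)),
      ← ENNReal.ofReal_mul ENNReal.toReal_nonneg]
    exact congrArg _ h1
  · intro i hi
    have := Finset.mem_range.1 hi
    rw [Function.update_of_ne (by omega), Function.update_of_ne (by omega)]

/-- The Markov property: on an event that is decided by time `n`, the expectation of `G (Sₙ₊₁)`
can be computed by averaging `G` over the row `Sₙ` of the transition matrix. -/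
lemma IsChainFrom.setLIntegral_succ (hS : IsChainFrom Q x P S) {n : ℕ}
    {A : Set Ω} (hA : MeasurableSet[hS.filtration n] A) (G : Z2 → ℝ≥0∞) :
    ∫⁻ ω in A, G (S (n + 1) ω) ∂P =
      ∫⁻ ω in A, ∑' z, ENNReal.ofReal (Q (S n ω) z) * G z ∂P := by
  have hatom (p : ℕ → Z2) : ∫⁻ ω in pathEvent S n p, G (S (n + 1) ω) ∂P =
      ∫⁻ ω in pathEvent S n p, ∑' z, ENNReal.ofReal (Q (S n ω) z) * G z ∂P := by
    have hG : Measurable G := measurable_of_countable G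
    have hmS := hS.measurable (n + 1)
    rw [← lintegral_map hG hmS, lintegral_countable']
    rw [setLIntegral_congr_fun (g := fun _ => ∑' z, ENNReal.ofReal (Q (p n) z) * G z)
      (hS.measurableSet_pathEvent n p) (fun ω hω => by simp only [hω n le_rfl]),
      setLIntegral_const, ← ENNReal.tsum_mul_right]
    refine tsum_congr fun z => ?_
    rw [Measure.map_apply hmS (measurableSet_singleton z),
      Measure.restrict_apply (hmS (measurableSet_singleton z)), Set.inter_comm]
    have := hS.measure_pathEvent_inter n p z
    rw [show S (n + 1) ⁻¹' {z} = {ω | S (n + 1) ω = z} from rfl, this]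
    ring
  obtain ⟨E, hd, rfl⟩ := hS.exists_eq_iUnion_pathEvent hA
  rw [lintegral_iUnion (fun q => hS.measurableSet_pathEvent n _) hd,
    lintegral_iUnion (fun q => hS.measurableSet_pathEvent n _) hd]
  exact tsum_congr fun q => hatom _

lemma IsChainFrom.lintegral_succ (hS : IsChainFrom Q x P S) (n : ℕ)
    (G : Z2 → ℝ≥0∞) :
    ∫⁻ ω, G (S (n + 1) ω) ∂P = ∫⁻ ω, ∑' z, ENNReal.ofReal (Q (S n ω) z) * G z ∂P := by
  simpa using hS.setLIntegral_succ (n := n) MeasurableSet.univ G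

lemma IsChainFrom.ae_zero (hS : IsChainFrom Q x P S) : ∀ᵐ ω ∂P, S 0 ω = x := by
  have h := hS.fdd 0 fun _ => x
  simp only [Nat.le_zero, forall_eq, if_pos, Finset.range_zero, Finset.prod_empty, mul_one] at h
  have h' : P {ω | S 0 ω = x} = 1 := by
    rw [← ENNReal.ofReal_toReal (measure_ne_top P _), ← ENNReal.ofReal_one]
    exact congrArg _ h
  exact (mem_ae_iff_prob_eq_one (hS.measurable 0 (measurableSet_singleton x))).2 h'

end Chain

/-! ### The conditioned walk: transition probabilities -/

lemma condP_nonneg (x y : Z2) : 0 ≤ condP x y := by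
  rw [condP]
  split_ifs
  · exact div_nonneg (potentialKernel_nonneg y)
      (mul_nonneg (by norm_num) (potentialKernel_nonneg x))
  · exact le_rfl

lemma condP_of_nbr {x y : Z2} (hx : x ≠ 0) (h : Nbr x y) :
    condP x y = potentialKernel y / (4 * potentialKernel x) := if_pos ⟨h, hx⟩

lemma condP_of_not_nbr {x y : Z2} (h : ¬ Nbr x y) : condP x y = 0 := if_neg fun h' => h h'.1

lemma condP_zero_left (y : Z2) : condP 0 y = 0 := if_neg fun h => h.2 rfl

lemma condP_zero_right (x : Z2) : condP x 0 = 0 := by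
  rw [condP]
  split_ifs <;> simp [potentialKernel_zero]

/-- The transition operator of the conditioned walk. At the origin, which is not in the state
space, its value is `0`, as it is a quotient by `potentialKernel 0 = 0`. -/
noncomputable def condMean (f : Z2 → ℝ) (x : Z2) : ℝ :=
  nbrMean (fun z => potentialKernel z * f z) x / potentialKernel x

lemma condMean_zero (f : Z2 → ℝ) : condMean f 0 = 0 := by
  rw [condMean, potentialKernel_zero, div_zero]

lemma condMean_nonneg {f : Z2 → ℝ} (hf : ∀ z, 0 ≤ f z) (x : Z2) : 0 ≤ condMean f x :=
  div_nonneg (nbrMean_nonneg (fun z => mul_nonneg (potentialKernel_nonneg z) (hf z)) x)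
    (potentialKernel_nonneg x)

lemma condMean_mono {f g : Z2 → ℝ} (h : ∀ z, f z ≤ g z) (x : Z2) : condMean f x ≤ condMean g x :=
  div_le_div_of_nonneg_right
    (nbrMean_mono fun z => mul_le_mul_of_nonneg_left (h z) (potentialKernel_nonneg z))
    (potentialKernel_nonneg x)

lemma sum_condP_mul (f : Z2 → ℝ) {x : Z2} (hx : x ≠ 0) :
    ∑ z ∈ nbrs x, condP x z * f z = condMean f x := by
  rw [condMean, nbrMean_eq_sum, div_div, Finset.sum_div]
  refine Finset.sum_congr rfl fun z hz => ?_
  rw [condP_of_nbr hx (mem_nbrs.1 hz)]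
  ring

lemma tsum_condP_mul {f : Z2 → ℝ} (hf : ∀ z, 0 ≤ f z) (x : Z2) :
    ∑' z, ENNReal.ofReal (condP x z) * ENNReal.ofReal (f z) = ENNReal.ofReal (condMean f x) := by
  by_cases hx : x = 0
  · subst hx
    simp [condP_zero_left, condMean_zero]
  · rw [tsum_eq_sum (s := nbrs x), ← sum_condP_mul f hx, ENNReal.ofReal_sum_of_nonneg]
    · exact Finset.sum_congr rfl fun z _ => (ENNReal.ofReal_mul (condP_nonneg x z)).symm
    · exact fun z _ => mul_nonneg (condP_nonneg x z) (hf z)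
    · intro z hz
      rw [condP_of_not_nbr fun h => hz (mem_nbrs.2 h), ENNReal.ofReal_zero, zero_mul]

lemma isReversibleOn_condP :
    IsReversibleOn {x | x ≠ 0} condP (fun x => potentialKernel x ^ 2) where
  pos x hx := pow_pos (potentialKernel_pos hx) 2
  balance x hx y hy := by
    by_cases h : Nbr x y
    · have hx' := potentialKernel_ne_zero hx
      have hy' := potentialKernel_ne_zero hy
      rw [condP_of_nbr hx h, condP_of_nbr hy ((nbr_comm x y).1 h)]
      field_simp
    · rw [condP_of_not_nbr h, condP_of_not_nbr fun h' => h ((nbr_comm x y).2 h')]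
      simp

lemma finsum_conductance {x : Z2} (hx : x ≠ 0) :
    ∑ᶠ (z) (_ : Nbr x z), potentialKernel x * potentialKernel z = 4 * potentialKernel x ^ 2 := by
  have h : ∑ᶠ (z) (_ : Nbr x z), potentialKernel x * potentialKernel z =
      ∑ z ∈ nbrs x, potentialKernel x * potentialKernel z := by
    rw [← finsum_mem_finset_eq_sum]
    simp only [mem_nbrs]
  have h2 := nbrMean_potentialKernel hx
  rw [nbrMean_eq_sum, div_eq_iff (by norm_num)] at h2
  rw [h, ← Finset.mul_sum, h2]
  ring

lemma isConductanceWalkOn_condP :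
    IsConductanceWalkOn {x | x ≠ 0} condP (fun x y => potentialKernel x * potentialKernel y) where
  symm x y _ := mul_comm _ _
  nonneg x y _ := mul_nonneg (potentialKernel_nonneg x) (potentialKernel_nonneg y)
  total_pos x hx := by
    rw [finsum_conductance hx]
    have := potentialKernel_pos hx
    positivity
  edge x hx y h := by
    have := potentialKernel_ne_zero hx
    rw [finsum_conductance hx, condP_of_nbr hx h]
    field_simp
  not_edge x _ y h := condP_of_not_nbr h

/-! ### Existence of the conditioned walk -/

/-- The distribution of the next site of the conditioned walk; at the origin, which the walk does
not visit, it is an arbitrary probability measure. -/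
noncomputable def condRow (x : Z2) : PMF Z2 :=
  if hx : x ≠ 0 then
    PMF.ofFinset (fun z => ENNReal.ofReal (condP x z)) (nbrs x)
      (by
        have h := sum_condP_mul (fun _ => 1) hx
        simp only [mul_one, condMean, nbrMean_potentialKernel hx] at h
        rw [← ENNReal.ofReal_sum_of_nonneg fun z _ => condP_nonneg x z, h,
          div_self (potentialKernel_ne_zero hx), ENNReal.ofReal_one])
      (fun z hz => by rw [condP_of_not_nbr fun h => hz (mem_nbrs.2 h), ENNReal.ofReal_zero])
  else PMF.pure 0

lemma condRow_apply {x : Z2} (hx : x ≠ 0) (z : Z2) :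
    condRow x z = ENNReal.ofReal (condP x z) := by
  rw [condRow, dif_pos hx]
  rfl

/-- The walk from `x` that moves at time `n` from its site `z` to the site `ω n z`. -/
def walkOf (x : Z2) : ℕ → (ℕ → Z2 → Z2) → Z2
  | 0, _ => x
  | n + 1, ω => ω n (walkOf x n ω)

lemma measurable_walkOf (x : Z2) (n : ℕ) : Measurable (walkOf x n) := by
  induction n with
  | zero => exact measurable_const
  | succ n ih =>
    refine measurable_to_countable' fun z => ?_
    have : walkOf x (n + 1) ⁻¹' {z} =
        ⋃ w, walkOf x n ⁻¹' {w} ∩ (fun ω : ℕ → Z2 → Z2 => ω n w) ⁻¹' {z} := by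
      ext ω
      simp [walkOf]
    rw [this]
    refine MeasurableSet.iUnion fun w => (ih (measurableSet_singleton w)).inter ?_
    exact ((measurable_pi_apply w).comp (measurable_pi_apply n)) (measurableSet_singleton z)

/-- For a path from `x ≠ 0`, the rows of the transition matrix may be replaced by the
distributions `condRow`: these differ only at the origin, which a path of positive weight cannot
reach. -/
lemma prod_condRow {n : ℕ} {p : ℕ → Z2} (hp : p 0 ≠ 0) :
    ∏ i ∈ Finset.range n, condRow (p i) (p (i + 1)) =
      ENNReal.ofReal (∏ i ∈ Finset.range n, condP (p i) (p (i + 1))) := by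
  rw [ENNReal.ofReal_prod_of_nonneg fun i _ => condP_nonneg _ _]
  by_cases h : ∀ i < n, p i ≠ 0
  · exact Finset.prod_congr rfl fun i hi => condRow_apply (h i (Finset.mem_range.1 hi)) _
  · push Not at h
    classical
    obtain ⟨hlt, h0⟩ := Nat.find_spec h
    obtain ⟨j, hj⟩ : ∃ j, Nat.find h = j + 1 := Nat.exists_eq_succ_of_ne_zero fun h' => by
      rw [h'] at h0
      exact hp h0
    rw [hj] at hlt h0
    have hj0 : p j ≠ 0 := fun h' => Nat.find_min h (m := j) (by omega) ⟨by omega, h'⟩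
    rw [Finset.prod_eq_zero (Finset.mem_range.2 (show j < n by omega)),
      Finset.prod_eq_zero (Finset.mem_range.2 hlt)]
    · rw [h0, condP_zero_left, ENNReal.ofReal_zero]
    · rw [h0, condRow_apply hj0, condP_zero_right, ENNReal.ofReal_zero]

theorem exists_isChainFrom_condP {x : Z2} (hx : x ≠ 0) :
    ∃ P : Measure (ℕ → Z2), IsProbabilityMeasure P ∧
      IsChainFrom condP x P (fun n ω => ω n) := by
  let ν : Measure (Z2 → Z2) := Measure.infinitePi fun z => (condRow z).toMeasure
  let P' : Measure (ℕ → Z2 → Z2) := Measure.infinitePi fun _ => ν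
  have hmeas : Measurable fun (ω : ℕ → Z2 → Z2) n => walkOf x n ω :=
    measurable_pi_lambda _ fun n => measurable_walkOf x n
  refine ⟨P'.map fun ω n => walkOf x n ω, Measure.isProbabilityMeasure_map hmeas.aemeasurable,
    fun n => measurable_pi_apply n, fun n p => ?_⟩
  have hset : MeasurableSet {ω : ℕ → Z2 | ∀ i ≤ n, ω i = p i} := by
    have : {ω : ℕ → Z2 | ∀ i ≤ n, ω i = p i} =
        ⋂ i, ⋂ (_ : i ≤ n), (fun ω : ℕ → Z2 => ω i) ⁻¹' {p i} := by
      ext ω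
      simp
    rw [this]
    exact MeasurableSet.iInter fun i => MeasurableSet.iInter fun _ =>
      measurable_pi_apply i (measurableSet_singleton _)
  rw [Measure.real, Measure.map_apply hmeas hset]
  by_cases hp : p 0 = x
  · have hpre : (fun (ω : ℕ → Z2 → Z2) n => walkOf x n ω) ⁻¹' {ω | ∀ i ≤ n, ω i = p i} =
        Set.pi (Finset.range n) fun i => {v | v (p i) = p (i + 1)} := by
      ext ω
      simp only [Set.mem_preimage, Set.mem_ofPred_eq, Set.mem_pi, Finset.coe_range, Set.mem_Iio]
      constructor
      · intro h i hi
        rw [← h (i + 1) hi, walkOf, h i hi.le]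
      · intro h i
        induction i with
        | zero => intro _; rw [walkOf, hp]
        | succ i ih => intro hi; rw [walkOf, ih (by omega), h i hi]
    have hone (i : ℕ) : ν {v | v (p i) = p (i + 1)} = condRow (p i) (p (i + 1)) := by
      have := Measure.infinitePi_pi (μ := fun z => (condRow z).toMeasure) (s := {p i})
        (t := fun _ => {p (i + 1)}) (fun _ _ => measurableSet_singleton _)
      rw [Finset.prod_singleton, PMF.toMeasure_apply_singleton _ _ (measurableSet_singleton _)]
        at this
      rw [← this]
      congr 1
      ext v
      simp
    rw [hpre, Measure.infinitePi_pi]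
    · simp only [hone]
      rw [prod_condRow (hp ▸ hx), if_pos hp, one_mul, ENNReal.toReal_ofReal]
      exact Finset.prod_nonneg fun i _ => condP_nonneg _ _
    · intro i _
      exact (measurable_pi_apply (p i) : Measurable fun v : Z2 → Z2 => v (p i))
        (measurableSet_singleton (p (i + 1)))
  · have hpre : (fun (ω : ℕ → Z2 → Z2) n => walkOf x n ω) ⁻¹' {ω | ∀ i ≤ n, ω i = p i} = ∅ := by
      ext ω
      simp only [Set.mem_preimage, Set.mem_ofPred_eq, Set.mem_empty_iff_false, iff_false]
      exact fun h => hp (h 0 (Nat.zero_le n)).symm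
    rw [hpre, if_neg hp]
    simp

/-! ### Superharmonic functions for the conditioned walk -/

/-- Twice the product of `potentialKernel y` and the probability that the simple random walk from
`x` visits `y` before the origin. -/
noncomputable def capKernel (y x : Z2) : ℝ :=
  potentialKernel x + potentialKernel y - potentialKernel (x - y)

lemma capKernel_nonneg (y x : Z2) : 0 ≤ capKernel y x := by
  have h := potentialKernel_add_le x (-y)
  rw [potentialKernel_neg, ← sub_eq_add_neg] at h
  exact sub_nonneg.2 h

lemma capKernel_le (y x : Z2) : capKernel y x ≤ 2 * potentialKernel y := by
  have h := potentialKernel_add_le (x - y) y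
  rw [sub_add_cancel] at h
  rw [capKernel]
  linarith

lemma capKernel_zero (y : Z2) : capKernel y 0 = 0 := by
  rw [capKernel, zero_sub, potentialKernel_neg, potentialKernel_zero]
  ring

lemma capKernel_self (y : Z2) : capKernel y y = 2 * potentialKernel y := by
  rw [capKernel, sub_self, potentialKernel_zero]
  ring

lemma nbrMean_capKernel (y x : Z2) : nbrMean (capKernel y) x =
    nbrMean potentialKernel x + potentialKernel y - nbrMean potentialKernel (x - y) := by
  simp only [nbrMean, capKernel, sub_add_eq_add_sub, sub_right_comm x y]
  ring

lemma nbrMean_capKernel_of_ne {x y : Z2} (hx : x ≠ 0) (hxy : x ≠ y) :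
    nbrMean (capKernel y) x = capKernel y x := by
  rw [nbrMean_capKernel, nbrMean_potentialKernel hx, nbrMean_potentialKernel (sub_ne_zero.2 hxy),
    capKernel]

lemma nbrMean_capKernel_self {y : Z2} (hy : y ≠ 0) :
    nbrMean (capKernel y) y = 2 * potentialKernel y - 1 := by
  rw [nbrMean_capKernel, nbrMean_potentialKernel hy, sub_self, nbrMean_potentialKernel_zero]
  ring

/-- An upper bound for the Green function of the conditioned walk with target `y`. -/
noncomputable def condGreen (y x : Z2) : ℝ :=
  potentialKernel y * capKernel y x / potentialKernel x

lemma condGreen_nonneg (y x : Z2) : 0 ≤ condGreen y x :=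
  div_nonneg (mul_nonneg (potentialKernel_nonneg y) (capKernel_nonneg y x))
    (potentialKernel_nonneg x)

lemma condGreen_eq {y : Z2} (hy : y ≠ 0) (x : Z2) :
    condGreen y x = (if x = y then 1 else 0) + condMean (condGreen y) x := by
  have hmul (z : Z2) :
      potentialKernel z * condGreen y z = potentialKernel y * capKernel y z := by
    by_cases hz : z = 0
    · rw [hz, potentialKernel_zero, capKernel_zero]
      ring
    · rw [condGreen, mul_div_cancel₀ _ (potentialKernel_ne_zero hz)]
  have hmean : condMean (condGreen y) x =
      potentialKernel y * nbrMean (capKernel y) x / potentialKernel x := by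
    rw [condMean]
    congr 1
    simp only [nbrMean, hmul]
    ring
  by_cases hx : x = 0
  · rw [if_neg (hx ▸ hy.symm), hx, condMean_zero, condGreen, potentialKernel_zero]
    simp
  by_cases hxy : x = y
  · have := potentialKernel_ne_zero hy
    rw [if_pos hxy, hmean, hxy, nbrMean_capKernel_self hy, condGreen, capKernel_self]
    field_simp
    ring
  · rw [if_neg hxy, hmean, nbrMean_capKernel_of_ne hx hxy, condGreen, zero_add]

lemma condMean_inv {x : Z2} (hx : ¬ Nbr 0 x) :
    condMean (fun z => 1 / potentialKernel z) x = 1 / potentialKernel x := by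
  by_cases hx0 : x = 0
  · rw [hx0, condMean_zero, potentialKernel_zero, div_zero]
  · have h (z : Z2) (hz : Nbr x z) : potentialKernel z * (1 / potentialKernel z) = 1 := by
      refine mul_one_div_cancel (potentialKernel_ne_zero ?_)
      rintro rfl
      exact hx ((nbr_comm _ _).1 hz)
    rw [condMean, nbrMean_congr (g := fun _ => 1) h, nbrMean]
    norm_num

/-! ### The martingale -/

section Times

variable {Ω : Type*} {S : ℕ → Ω → Z2}

lemma lt_entranceTime_iff {A : Set Z2} {n : ℕ} {ω : Ω} :
    WithTop.some n < entranceTime S A ω ↔ ∀ j ≤ n, S j ω ∉ A := by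
  rw [← not_le, entranceTime, hittingAfter_le_iff]
  simp

lemma le_entranceTime_iff {A : Set Z2} {n : ℕ} {ω : Ω} :
    WithTop.some n ≤ entranceTime S A ω ↔ ∀ j < n, S j ω ∉ A := by
  rw [← not_lt, entranceTime, hittingAfter_lt_iff]
  simp

lemma entranceTime_lt_top_iff {A : Set Z2} {ω : Ω} :
    entranceTime S A ω < ⊤ ↔ ∃ j, S j ω ∈ A := by
  rw [lt_top_iff_ne_top, entranceTime, ne_eq, hittingAfter_eq_top_iff]
  simp

lemma hitTime_lt_top_iff {A : Set Z2} {ω : Ω} :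
    hitTime S A ω < ⊤ ↔ ∃ j, 1 ≤ j ∧ S j ω ∈ A := by
  rw [lt_top_iff_ne_top, hitTime, ne_eq, hittingAfter_eq_top_iff]
  push Not
  rfl

/-- The event that the walk does not visit `y` at a time in `[1, n]`. -/
def avoidEvent (S : ℕ → Ω → Z2) (y : Z2) (n : ℕ) : Set Ω := {ω | ∀ j, 1 ≤ j → j ≤ n → S j ω ≠ y}

lemma avoidEvent_anti (y : Z2) : Antitone (avoidEvent S y) :=
  fun _ _ h _ hω j h1 hj => hω j h1 (hj.trans h)

end Times

section Chain

variable {x : Z2} {Ω : Type*} [MeasurableSpace Ω] {P : Measure Ω} {S : ℕ → Ω → Z2}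

lemma measurableSet_avoidEvent (hS : IsChainFrom condP x P S) (y : Z2) (n : ℕ) :
    MeasurableSet[hS.filtration n] (avoidEvent S y n) := by
  have : avoidEvent S y n = ⋂ j, ⋂ (_ : 1 ≤ j), ⋂ (_ : j ≤ n), {ω | S j ω ∈ {z | z ≠ y}} := by
    ext ω
    simp [avoidEvent]
  rw [this]
  exact MeasurableSet.iInter fun j => MeasurableSet.iInter fun _ => MeasurableSet.iInter fun hj =>
    hS.measurableSet_filtration hj _

variable [IsProbabilityMeasure P]

theorem martingale_stoppedProcess_inv (hS : IsChainFrom condP x P S) :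
    Martingale (stoppedProcess (fun n ω => 1 / potentialKernel (S n ω))
      (entranceTime S {y | Nbr 0 y})) hS.filtration P := by
  set τ := entranceTime S {y | Nbr 0 y}
  set M := stoppedProcess (fun n ω => 1 / potentialKernel (S n ω)) τ
  have hpos (n : ℕ) (ω : Ω) : 0 ≤ M n ω := one_div_nonneg.2 (potentialKernel_nonneg _)
  have hadapted : StronglyAdapted hS.filtration M := by
    have hS' : Adapted hS.filtration S := fun n B _ =>
      hS.measurableSet_filtration le_rfl B
    refine StronglyAdapted.stoppedProcess_of_discrete (fun n => ?_)
      (hS'.isStoppingTime_hittingAfter (Set.to_countable _).measurableSet)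
    exact ((measurable_of_countable fun z => 1 / potentialKernel z).comp
      (hS' n)).stronglyMeasurable
  have hmeas (n : ℕ) : Measurable (M n) := (hadapted n).measurable.mono (hS.filtration.le n) le_rfl
  have hstep (n : ℕ) (s : Set Ω) (hs : MeasurableSet[hS.filtration n] s) :
      ∫⁻ ω in s, ENNReal.ofReal (M n ω) ∂P = ∫⁻ ω in s, ENNReal.ofReal (M (n + 1) ω) ∂P := by
    set D : Set Ω := {ω | ∀ j ≤ n, ¬ Nbr 0 (S j ω)}
    have hDF : MeasurableSet[hS.filtration n] D := by
      have : D = ⋂ j, ⋂ (_ : j ≤ n), {ω | S j ω ∈ {z | ¬ Nbr 0 z}} := by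
        ext ω
        simp [D]
      rw [this]
      exact MeasurableSet.iInter fun j => MeasurableSet.iInter fun hj =>
        hS.measurableSet_filtration hj _
    have hD := hS.filtration.le n _ hDF
    have hs' := hS.filtration.le n _ hs
    rw [← lintegral_inter_add_sdiff _ s hD,
      ← lintegral_inter_add_sdiff (fun ω => ENNReal.ofReal (M (n + 1) ω)) s hD]
    congr 1
    · have h1 : ∫⁻ ω in s ∩ D, ENNReal.ofReal (M (n + 1) ω) ∂P =
          ∫⁻ ω in s ∩ D, ENNReal.ofReal (1 / potentialKernel (S (n + 1) ω)) ∂P := by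
        refine setLIntegral_congr_fun (hs'.inter hD) fun ω hω => ?_
        have hle : WithTop.some (n + 1) ≤ τ ω :=
          le_entranceTime_iff.2 fun j hj => hω.2 j (Nat.lt_succ_iff.1 hj)
        exact congrArg ENNReal.ofReal (stoppedProcess_eq_of_le hle)
      rw [h1, hS.setLIntegral_succ (MeasurableSet.inter hs hDF)
        (fun z => ENNReal.ofReal (1 / potentialKernel z))]
      refine setLIntegral_congr_fun (hs'.inter hD) fun ω hω => ?_
      have hle : WithTop.some n ≤ τ ω :=
        le_entranceTime_iff.2 fun j hj => hω.2 j hj.le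
      have hM : M n ω = 1 / potentialKernel (S n ω) := stoppedProcess_eq_of_le hle
      rw [hM, tsum_condP_mul (fun z => one_div_nonneg.2 (potentialKernel_nonneg z)),
        condMean_inv (hω.2 n le_rfl)]
    · refine setLIntegral_congr_fun (hs'.diff hD) fun ω hω => ?_
      have hle : τ ω ≤ WithTop.some n := not_lt.1 fun h => hω.2 (lt_entranceTime_iff.1 h)
      have hle' : τ ω ≤ WithTop.some (n + 1) := hle.trans (WithTop.coe_le_coe.2 n.le_succ)
      have h1 : M n ω = 1 / potentialKernel (S (τ ω).untopA ω) := stoppedProcess_eq_of_ge hle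
      have h2 : M (n + 1) ω = 1 / potentialKernel (S (τ ω).untopA ω) :=
        stoppedProcess_eq_of_ge hle'
      rw [h1, h2]
  have hfin (n : ℕ) : ∫⁻ ω, ENNReal.ofReal (M n ω) ∂P < ∞ := by
    induction n with
    | zero =>
      have : ∫⁻ ω, ENNReal.ofReal (M 0 ω) ∂P =
          ∫⁻ _, ENNReal.ofReal (1 / potentialKernel x) ∂P := by
        refine lintegral_congr_ae ?_
        filter_upwards [hS.ae_zero] with ω hω
        simp [M, stoppedProcess, hω]
      rw [this]
      simp
    | succ n ih =>
      have := hstep n Set.univ MeasurableSet.univ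
      rw [Measure.restrict_univ] at this
      rwa [← this]
  refine martingale_of_setIntegral_eq_succ hadapted (fun n => ?_) fun n s hs => ?_
  · refine ⟨(hmeas n).aestronglyMeasurable, ?_⟩
    rw [hasFiniteIntegral_iff_ofReal (Eventually.of_forall (hpos n))]
    exact hfin n
  · rw [integral_eq_lintegral_of_nonneg_ae (Eventually.of_forall (hpos n))
        (hmeas n).aestronglyMeasurable,
      integral_eq_lintegral_of_nonneg_ae (Eventually.of_forall (hpos (n + 1)))
        (hmeas (n + 1)).aestronglyMeasurable, hstep n s hs]

/-! ### Transience -/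

/-- Since `condGreen y` exceeds its image under the transition operator by the indicator of `y`,
it drops in expectation at each time by the probability of a visit to `y`. Hence the expected
number of visits to `y` is at most `condGreen y x`. -/
lemma sum_measure_visit_add (hS : IsChainFrom condP x P S) {y : Z2} (hy : y ≠ 0) (N : ℕ) :
    ∑ n ∈ Finset.range N, P {ω | S n ω = y} + ∫⁻ ω, ENNReal.ofReal (condGreen y (S N ω)) ∂P =
      ENNReal.ofReal (condGreen y x) := by
  induction N with
  | zero =>
    have : ∫⁻ ω, ENNReal.ofReal (condGreen y (S 0 ω)) ∂P =
        ∫⁻ _, ENNReal.ofReal (condGreen y x) ∂P := by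
      refine lintegral_congr_ae ?_
      filter_upwards [hS.ae_zero] with ω hω
      rw [hω]
    rw [this]
    simp
  | succ N ih =>
    have hN := hS.measurable N (measurableSet_singleton y)
    have h1 (ω : Ω) : ENNReal.ofReal (condGreen y (S N ω)) =
        (S N ⁻¹' {y}).indicator 1 ω + ∑' z, ENNReal.ofReal (condP (S N ω) z) *
          ENNReal.ofReal (condGreen y z) := by
      rw [tsum_condP_mul (condGreen_nonneg y), condGreen_eq hy (S N ω),
        ENNReal.ofReal_add (by split_ifs <;> norm_num)
          (condMean_nonneg (condGreen_nonneg y) _)]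
      congr 1
      by_cases h : S N ω = y <;> simp [h]
    rw [← ih, Finset.sum_range_succ, add_assoc, lintegral_congr h1,
      lintegral_add_left (measurable_one.indicator hN), lintegral_indicator_one hN,
      hS.lintegral_succ N fun z => ENNReal.ofReal (condGreen y z)]
    rfl

lemma measure_zero_eq_zero (hS : IsChainFrom condP x P S) (hx : x ≠ 0) (n : ℕ) :
    P {ω | S n ω = 0} = 0 := by
  cases n with
  | zero =>
    refine measure_mono_null (fun ω hω => ?_) (ae_iff.1 hS.ae_zero)
    exact fun h => hx (h.symm.trans hω)
  | succ n =>
    have h0 := hS.measurable (n + 1) (measurableSet_singleton (0 : Z2))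
    have h := hS.lintegral_succ n fun z => ({0} : Set Z2).indicator 1 z
    have h2 (w : Z2) : ∑' z, ENNReal.ofReal (condP w z) * ({0} : Set Z2).indicator 1 z = 0 := by
      rw [ENNReal.tsum_eq_zero]
      intro z
      by_cases hz : z = 0 <;> simp [hz, condP_zero_right]
    simp only [h2, lintegral_zero] at h
    exact (lintegral_indicator_one h0).symm.trans h

theorem ae_finite_visits (hS : IsChainFrom condP x P S) (hx : x ≠ 0) :
    ∀ᵐ ω ∂P, ∀ y : Z2, {n : ℕ | S n ω = y}.Finite := by
  refine ae_all_iff.2 fun y => ae_finite_setOfPred_mem (s := fun n => {ω | S n ω = y}) ?_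
  by_cases hy : y = 0
  · simp [hy, measure_zero_eq_zero hS hx]
  · refine ne_top_of_le_ne_top (ENNReal.ofReal_ne_top (r := condGreen y x)) ?_
    rw [ENNReal.tsum_eq_iSup_nat]
    exact iSup_le fun N => le_self_add.trans (sum_measure_visit_add hS hy N).le

/-! ### Hitting probabilities -/

/-- The probability that the conditioned walk from `x` visits `y` at a time in `[1, m]`. -/
noncomputable def hitProb (y : Z2) : ℕ → Z2 → ℝ
  | 0 => 0
  | m + 1 => condMean (Function.update (hitProb y m) y 1)

lemma hitProb_nonneg (y : Z2) (m : ℕ) : ∀ z, 0 ≤ hitProb y m z := by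
  induction m with
  | zero => exact fun _ => le_rfl
  | succ m ih =>
    refine condMean_nonneg fun z => ?_
    by_cases hz : z = y
    · rw [hz, Function.update_self]; exact zero_le_one
    · rw [Function.update_of_ne hz]; exact ih z

lemma update_hitProb_nonneg (y : Z2) (m : ℕ) (z : Z2) :
    0 ≤ Function.update (hitProb y m) y 1 z := by
  by_cases hz : z = y
  · rw [hz, Function.update_self]; exact zero_le_one
  · rw [Function.update_of_ne hz]; exact hitProb_nonneg y m z

lemma setLIntegral_hitProb (hS : IsChainFrom condP x P S) (y : Z2) (m : ℕ) : ∀ n,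
    ∫⁻ ω in avoidEvent S y n, ENNReal.ofReal (hitProb y m (S n ω)) ∂P =
      P (avoidEvent S y n \ avoidEvent S y (n + m)) := by
  induction m with
  | zero => intro n; simp [hitProb]
  | succ m ih =>
    intro n
    have hm (k : ℕ) : MeasurableSet (avoidEvent S y k) :=
      hS.filtration.le k _ (measurableSet_avoidEvent hS y k)
    have hy : MeasurableSet (S (n + 1) ⁻¹' {y}) :=
      hS.measurable (n + 1) (measurableSet_singleton y)
    have hdiff : avoidEvent S y n \ S (n + 1) ⁻¹' {y} = avoidEvent S y (n + 1) := by
      ext ω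
      simp only [avoidEvent, Set.mem_sdiff, Set.mem_ofPred_eq, Set.mem_preimage,
        Set.mem_singleton_iff]
      constructor
      · rintro ⟨h, h'⟩ j h1 hj
        rcases Nat.lt_or_eq_of_le hj with hj | rfl
        · exact h j h1 (Nat.lt_succ_iff.1 hj)
        · exact h'
      · exact fun h => ⟨fun j h1 hj => h j h1 (by omega), h _ (by omega) le_rfl⟩
    have h1 : ∫⁻ ω in avoidEvent S y n, ENNReal.ofReal (hitProb y (m + 1) (S n ω)) ∂P =
        ∫⁻ ω in avoidEvent S y n,
          ENNReal.ofReal (Function.update (hitProb y m) y 1 (S (n + 1) ω)) ∂P := by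
      rw [hS.setLIntegral_succ (measurableSet_avoidEvent hS y n)
        fun z => ENNReal.ofReal (Function.update (hitProb y m) y 1 z)]
      simp only [tsum_condP_mul (update_hitProb_nonneg y m)]
      rfl
    have h2 : ∫⁻ ω in avoidEvent S y n ∩ S (n + 1) ⁻¹' {y},
        ENNReal.ofReal (Function.update (hitProb y m) y 1 (S (n + 1) ω)) ∂P =
          P (avoidEvent S y n ∩ S (n + 1) ⁻¹' {y}) := by
      rw [setLIntegral_congr_fun (g := fun _ => 1) ((hm n).inter hy), setLIntegral_one]
      intro ω hω
      have hω' : S (n + 1) ω = y := hω.2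
      simp [hω']
    have h3 : ∫⁻ ω in avoidEvent S y (n + 1),
        ENNReal.ofReal (Function.update (hitProb y m) y 1 (S (n + 1) ω)) ∂P =
          ∫⁻ ω in avoidEvent S y (n + 1), ENNReal.ofReal (hitProb y m (S (n + 1) ω)) ∂P := by
      refine setLIntegral_congr_fun (hm (n + 1)) fun ω hω => ?_
      have hω' : S (n + 1) ω ≠ y := hω (n + 1) (by omega) le_rfl
      simp [Function.update_of_ne hω']
    rw [h1, ← lintegral_inter_add_sdiff _ _ hy, h2, hdiff, h3, ih,
      ← measure_union _ ((hm _).diff (hm _))]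
    · congr 1
      rw [← hdiff, show n + (m + 1) = n + 1 + m by ring]
      have hsub : avoidEvent S y (n + 1 + m) ⊆ avoidEvent S y n \ S (n + 1) ⁻¹' {y} :=
        hdiff ▸ avoidEvent_anti y (Nat.le_add_right _ _)
      ext ω
      have := @hsub ω
      simp only [Set.mem_union, Set.mem_inter_iff, Set.mem_sdiff] at this ⊢
      tauto
    · rw [← hdiff]
      exact Set.disjoint_left.2 fun ω h h' => h'.1.2 h.2

lemma measure_compl_avoidEvent (hS : IsChainFrom condP x P S) (y : Z2) (m : ℕ) :
    P (avoidEvent S y m)ᶜ = ENNReal.ofReal (hitProb y m x) := by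
  have huniv : avoidEvent S y 0 = Set.univ := by
    ext ω
    simp only [avoidEvent, Set.mem_ofPred_eq, Set.mem_univ, iff_true]
    intro j h1 h0
    omega
  have h := setLIntegral_hitProb hS y m 0
  rw [huniv, zero_add, ← Set.compl_eq_univ_sdiff, Measure.restrict_univ] at h
  rw [← h]
  have : ∫⁻ ω, ENNReal.ofReal (hitProb y m (S 0 ω)) ∂P =
      ∫⁻ _, ENNReal.ofReal (hitProb y m x) ∂P := by
    refine lintegral_congr_ae ?_
    filter_upwards [hS.ae_zero] with ω hω
    rw [hω]
  rw [this]
  simp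

lemma measureReal_hitTime_lt_top (hS : IsChainFrom condP x P S) {y : Z2} {b : ℝ}
    (hb : Tendsto (fun m => hitProb y m x) atTop (𝓝 b)) :
    P.real {ω | hitTime S {y} ω < ⊤} = b := by
  have hset : {ω | hitTime S {y} ω < ⊤} = ⋃ m, (avoidEvent S y m)ᶜ := by
    ext ω
    simp only [Set.mem_ofPred_eq, hitTime_lt_top_iff, Set.mem_iUnion, avoidEvent,
      Set.mem_compl_iff, Set.mem_singleton_iff]
    push Not
    exact ⟨fun ⟨j, h1, h⟩ => ⟨j, j, h1, le_rfl, h⟩, fun ⟨_, j, h1, _, h⟩ => ⟨j, h1, h⟩⟩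
  have hP : P {ω | hitTime S {y} ω < ⊤} = ENNReal.ofReal b := by
    rw [hset]
    refine tendsto_nhds_unique (tendsto_measure_iUnion_atTop
      (fun m n h => Set.compl_subset_compl.2 (avoidEvent_anti y h))) ?_
    refine Tendsto.congr (fun m => (measure_compl_avoidEvent hS y m).symm) ?_
    exact (ENNReal.continuous_ofReal.tendsto b).comp hb
  rw [Measure.real, hP, ENNReal.toReal_ofReal (ge_of_tendsto' hb (hitProb_nonneg y · x))]

end Chain

lemma hitProb_le_succ (y : Z2) (m : ℕ) : ∀ z, hitProb y m z ≤ hitProb y (m + 1) z := by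
  induction m with
  | zero => exact hitProb_nonneg y 1
  | succ m ih =>
    refine condMean_mono fun z => ?_
    by_cases hz : z = y
    · rw [hz, Function.update_self, Function.update_self]
    · rw [Function.update_of_ne hz, Function.update_of_ne hz]; exact ih z

/-- The probability that the simple random walk from `z` visits `y` at a time in `[0, m]` and
before the origin, multiplied by `potentialKernel y`. -/
noncomputable def killedHit (y : Z2) (m : ℕ) (z : Z2) : ℝ :=
  potentialKernel z * Function.update (hitProb y m) y 1 z

lemma hitProb_succ (y : Z2) (m : ℕ) (z : Z2) :
    hitProb y (m + 1) z = nbrMean (killedHit y m) z / potentialKernel z := rfl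

lemma killedHit_self (y : Z2) (m : ℕ) : killedHit y m y = potentialKernel y := by
  rw [killedHit, Function.update_self, mul_one]

lemma killedHit_zero (y : Z2) (m : ℕ) : killedHit y m 0 = 0 := by
  rw [killedHit, potentialKernel_zero, zero_mul]

lemma killedHit_succ {y z : Z2} (hz : z ≠ 0) (hzy : z ≠ y) (m : ℕ) :
    killedHit y (m + 1) z = nbrMean (killedHit y m) z := by
  rw [killedHit, Function.update_of_ne hzy, hitProb_succ,
    mul_div_cancel₀ _ (potentialKernel_ne_zero hz)]

lemma killedHit_nonneg (y : Z2) (m : ℕ) (z : Z2) : 0 ≤ killedHit y m z :=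
  mul_nonneg (potentialKernel_nonneg z) (update_hitProb_nonneg y m z)

lemma killedHit_le (y : Z2) (m : ℕ) : ∀ z, killedHit y m z ≤ potentialKernel y := by
  induction m with
  | zero =>
    intro z
    by_cases hzy : z = y
    · rw [hzy, killedHit_self]
    · rw [killedHit, Function.update_of_ne hzy]
      simpa [hitProb] using potentialKernel_nonneg y
  | succ m ih =>
    intro z
    by_cases hzy : z = y
    · rw [hzy, killedHit_self]
    by_cases hz : z = 0
    · rw [hz, killedHit_zero]
      exact potentialKernel_nonneg y
    · rw [killedHit_succ hz hzy, nbrMean]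
      linarith [ih (z + (1, 0)), ih (z - (1, 0)), ih (z + (0, 1)), ih (z - (0, 1))]

lemma killedHit_monotone (y z : Z2) : Monotone fun m => killedHit y m z := by
  refine monotone_nat_of_le_succ fun m => ?_
  refine mul_le_mul_of_nonneg_left ?_ (potentialKernel_nonneg z)
  by_cases hz : z = y
  · rw [hz, Function.update_self, Function.update_self]
  · rw [Function.update_of_ne hz, Function.update_of_ne hz]; exact hitProb_le_succ y m z

/-- The limit of `killedHit` and `capKernel y / 2` are bounded, harmonic off the origin and `y`,
and agree at these two points, so that they are equal by the maximum principle. -/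
theorem tendsto_killedHit (y z : Z2) :
    Tendsto (fun m => killedHit y m z) atTop (𝓝 (capKernel y z / 2)) := by
  set K : Z2 → ℝ := fun z => ⨆ m, killedHit y m z
  have hlim (z : Z2) : Tendsto (fun m => killedHit y m z) atTop (𝓝 (K z)) :=
    tendsto_atTop_ciSup (killedHit_monotone y z)
      ⟨potentialKernel y, by rintro _ ⟨m, rfl⟩; exact killedHit_le y m z⟩
  have hK0 : K 0 = 0 := by
    simp only [K, killedHit_zero, ciSup_const]
  have hKy : K y = potentialKernel y := by
    simp only [K, killedHit_self, ciSup_const]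
  have hK_le (z : Z2) : K z ≤ potentialKernel y := le_of_tendsto' (hlim z) (killedHit_le y · z)
  have hK_nonneg (z : Z2) : 0 ≤ K z := ge_of_tendsto' (hlim z) (killedHit_nonneg y · z)
  have hKmean (z : Z2) (hz : z ≠ 0) (hzy : z ≠ y) : nbrMean K z = K z := by
    refine tendsto_nhds_unique (tendsto_nbrMean hlim z) ?_
    refine ((tendsto_add_atTop_iff_nat 1).2 (hlim z)).congr fun m => ?_
    rw [killedHit_succ hz hzy]
  have h1 := nonpos_of_le_nbrMean (g := fun z => K z - capKernel y z / 2)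
    (C := potentialKernel y) (y := y)
    (fun z => by linarith [hK_le z, capKernel_nonneg y z])
    (by rw [hK0, capKernel_zero]; norm_num)
    (by rw [hKy, capKernel_self]; linarith)
    (fun z hz hzy => by
      have e1 := hKmean z hz hzy
      have e2 := nbrMean_capKernel_of_ne hz hzy
      simp only [nbrMean] at e1 e2 ⊢
      linarith) z
  have h2 := nonpos_of_le_nbrMean (g := fun z => capKernel y z / 2 - K z)
    (C := potentialKernel y) (y := y)
    (fun z => by linarith [hK_nonneg z, capKernel_le y z])
    (by rw [hK0, capKernel_zero]; norm_num)
    (by rw [hKy, capKernel_self]; linarith)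
    (fun z hz hzy => by
      have e1 := hKmean z hz hzy
      have e2 := nbrMean_capKernel_of_ne hz hzy
      simp only [nbrMean] at e1 e2 ⊢
      linarith) z
  have : K z = capKernel y z / 2 := by linarith
  exact this ▸ hlim z

lemma tendsto_hitProb (y x : Z2) :
    Tendsto (fun m => hitProb y m x) atTop
      (𝓝 (nbrMean (fun z => capKernel y z / 2) x / potentialKernel x)) := by
  refine (tendsto_add_atTop_iff_nat 1).1 ?_
  simp only [hitProb_succ]
  exact (tendsto_nbrMean (tendsto_killedHit y) x).div_const _

lemma nbrMean_div_two (f : Z2 → ℝ) (x : Z2) : nbrMean (fun z => f z / 2) x = nbrMean f x / 2 := by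
  simp only [nbrMean]
  ring

section Chain

variable {x : Z2} {Ω : Type*} [MeasurableSpace Ω] {P : Measure Ω} [IsProbabilityMeasure P]
  {S : ℕ → Ω → Z2}

theorem measureReal_hitTime_self (hS : IsChainFrom condP x P S) (hx : x ≠ 0) :
    P.real {ω | hitTime S {x} ω < ⊤} = 1 - 1 / (2 * potentialKernel x) := by
  have := potentialKernel_ne_zero hx
  rw [measureReal_hitTime_lt_top hS (tendsto_hitProb x x), nbrMean_div_two,
    nbrMean_capKernel_self hx]
  field_simp

theorem measureReal_hitTime_of_ne (hS : IsChainFrom condP x P S) (hx : x ≠ 0) {y : Z2}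
    (hxy : x ≠ y) :
    P.real {ω | hitTime S {y} ω < ⊤} = (potentialKernel x + potentialKernel y
      - potentialKernel (x - y)) / (2 * potentialKernel x) := by
  rw [measureReal_hitTime_lt_top hS (tendsto_hitProb y x), nbrMean_div_two,
    nbrMean_capKernel_of_ne hx hxy, div_div, capKernel]

theorem measure_hitTime_self_lt_one (hS : IsChainFrom condP x P S) (hx : x ≠ 0) :
    P {ω | hitTime S {x} ω < ⊤} < 1 := by
  have h := potentialKernel_pos hx
  rw [← ENNReal.ofReal_toReal (measure_ne_top P _), ENNReal.ofReal_lt_one]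
  refine (measureReal_hitTime_self hS hx).trans_lt ?_
  have : 0 < 1 / (2 * potentialKernel x) := by positivity
  linarith

lemma measure_entranceTime_eq (hS : IsChainFrom condP x P S) {y : Z2} (hxy : x ≠ y) :
    P {ω | entranceTime S {y} ω < ⊤} = P {ω | hitTime S {y} ω < ⊤} := by
  refine measure_congr ?_
  filter_upwards [hS.ae_zero] with ω hω
  refine propext ?_
  change entranceTime S {y} ω < ⊤ ↔ hitTime S {y} ω < ⊤
  rw [entranceTime_lt_top_iff, hitTime_lt_top_iff]
  refine ⟨fun ⟨j, hj⟩ => ⟨j, ?_, hj⟩, fun ⟨j, _, hj⟩ => ⟨j, hj⟩⟩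
  rcases Nat.eq_zero_or_pos j with rfl | h
  · exact absurd (hω.symm.trans hj) hxy
  · exact h

end Chain

end PlanarWalk

theorem proposition1 :
    -- the series defining the potential kernel converges, and the kernel is positive off `0`
    (∀ x : PlanarWalk.Z2, Tendsto (PlanarWalk.potentialPartial x) atTop
      (𝓝 (PlanarWalk.potentialKernel x))) ∧
    PlanarWalk.potentialKernel 0 = 0 ∧
    (∀ x : PlanarWalk.Z2, x ≠ 0 → 0 < PlanarWalk.potentialKernel x) ∧
    -- the conditioned walk from each `x ≠ 0` exists
    (∀ x : PlanarWalk.Z2, x ≠ 0 → ∃ P : Measure (ℕ → PlanarWalk.Z2), IsProbabilityMeasure P ∧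
      PlanarWalk.IsChainFrom PlanarWalk.condP x P (fun n ω => ω n)) ∧
    -- (i) reversibility
    PlanarWalk.IsReversibleOn {x | x ≠ 0} PlanarWalk.condP
      (fun x => PlanarWalk.potentialKernel x ^ 2) ∧
    -- (ii) conductances
    PlanarWalk.IsConductanceWalkOn {x | x ≠ 0} PlanarWalk.condP
      (fun x y => PlanarWalk.potentialKernel x * PlanarWalk.potentialKernel y) ∧
    -- (iii)-(v) hold for every realization of the walk from every `x ≠ 0`
    (∀ (x : PlanarWalk.Z2), x ≠ 0 →
      ∀ {Ω : Type*} [MeasurableSpace Ω] (P : Measure Ω) [IsProbabilityMeasure P]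
        (S : ℕ → Ω → PlanarWalk.Z2) (hS : PlanarWalk.IsChainFrom PlanarWalk.condP x P S),
      -- (iii) the stopped process is a martingale for the natural filtration of the walk
      Martingale
        (stoppedProcess (fun n ω => 1 / PlanarWalk.potentialKernel (S n ω))
          (PlanarWalk.entranceTime S {y | PlanarWalk.Nbr 0 y}))
        (Filtration.natural S (fun n => (hS.measurable n).stronglyMeasurable)) P ∧
      -- (iv) transience
      P {ω | PlanarWalk.hitTime S {x} ω < ⊤} < 1 ∧
      (∀ᵐ ω ∂P, ∀ y : PlanarWalk.Z2, {n : ℕ | S n ω = y}.Finite) ∧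
      -- (v) return and hitting probabilities
      P.real {ω | PlanarWalk.hitTime S {x} ω < ⊤}
        = 1 - 1 / (2 * PlanarWalk.potentialKernel x) ∧
      ∀ y : PlanarWalk.Z2, y ≠ 0 → x ≠ y →
        P.real {ω | PlanarWalk.entranceTime S {y} ω < ⊤}
            = P.real {ω | PlanarWalk.hitTime S {y} ω < ⊤} ∧
        P.real {ω | PlanarWalk.hitTime S {y} ω < ⊤}
          = (PlanarWalk.potentialKernel x + PlanarWalk.potentialKernel y
              - PlanarWalk.potentialKernel (x - y)) / (2 * PlanarWalk.potentialKernel x)) := by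
  refine ⟨PlanarWalk.tendsto_potentialPartial, PlanarWalk.potentialKernel_zero,
    fun _ => PlanarWalk.potentialKernel_pos, fun _ => PlanarWalk.exists_isChainFrom_condP,
    PlanarWalk.isReversibleOn_condP, PlanarWalk.isConductanceWalkOn_condP, ?_⟩
  intro x hx Ω _ P _ S hS
  exact ⟨PlanarWalk.martingale_stoppedProcess_inv hS, PlanarWalk.measure_hitTime_self_lt_one hS hx,
    PlanarWalk.ae_finite_visits hS hx, PlanarWalk.measureReal_hitTime_self hS hx,
    fun y _ hxy => ⟨congrArg ENNReal.toReal (PlanarWalk.measure_entranceTime_eq hS hxy),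
      PlanarWalk.measureReal_hitTime_of_ne hS hx hxy⟩⟩
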